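/- Let $\Omega\subseteq\mathbb{C}$ be a domain (a non-empty connected open set). For a non-empty set $F\subseteq\mathbb{N}_0=\{0,1,2,\dots\}$ let $H_F^\infty(\Omega)$ be the space of holomorphic $f:\Omega\to\mathbb{C}$ such that $f^{(l)}$ is bounded on $\Omega$ for every $l\in F$, and let $\mathcal{A}_F(\Omega)$ be the space of holomorphic $f:\Omega\to\mathbb{C}$ such that $f^{(l)}$ has a continuous extension (also denoted $f^{(l)}$) to the closure $\overline{\Omega}$ of $\Omega$ in $\mathbb{C}$ for every $l\in F$. Fix $z_0\in\Omega$. The topology of $H_F^\infty(\Omega)$ is the one induced by the seminorms $\sup_{z\in\Omega}|f^{(l)}(z)|$, $l\in F$, and $|f^{(l)}(z_0)|$, $0\le l<\min F$; the topology of $\mathcal{A}_F(\Omega)$ is the one induced by the seminorms $\sup\{|f^{(l)}(z)|: z\in\overline{\Omega},\ |z|\le n\}$, $l\in F$, $n\in\mathbb{N}$, and $|f^{(l)}(z_0)|$, $0\le l<\min F$. Call a pair $(D_1,D_2)$ of open discs admissible if $D_2\cap\Omega\ne\varnothing$, $D_2\cap\Omega^c\ne\varnothing$ and $\overline{D_1}\subseteq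 D_2\cap\Omega$. A holomorphic $f:\Omega\to\mathbb{C}$ is extendable if there are an admissible pair $(D_1,D_2)$ and a holomorphic function on $D_2$ which coincides with $f$ on $D_1$; otherwise it is non-extendable. Suppose first that every $\zeta\in\partial\Omega$ is the limit of a sequence of points of $\mathbb{C}\setminus\overline{\Omega}$. Then: 1. for every non-empty $F\subseteq\mathbb{N}_0$ and every choice of $z_0\in\Omega$, the set of non-extendable functions in $H_F^\infty(\Omega)$ is a dense $G_\delta$ subset of $H_F^\infty(\Omega)$, and the set of non-extendable functions in $\mathcal{A}_F(\Omega)$ is a dense $G_\delta$ subset of $\mathcal{A}_F(\Omega)$; 2. for every admissible pair $(D_1,D_2)$ the set $D_2\setminus\overline{\Omega}$ is non-empty. Moreover, for every domain $\Omega\subseteq\mathbb{C}$: 3. for every $w\in\mathbb{C}\setminus\overline{\Omega}$, the function $z\mapsto\frac{1}{z-w}$ on $\Omega$ belongs to $H_F^\infty(\Omega)\cap\mathcal{A}_F(\Omega)$ for every $F$, and for every admissible pair $(D_1,D_2)$ with $w\in D_2$ its restriction to $D_1$ has no holomorphic extension to $D_2$; 4. if $\partial\Omega$ is the union of finitely many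 pairwise disjoint Jordan curves, then every $\zeta\in\partial\Omega$ is the limit of a sequence of points of $\mathbb{C}\setminus\overline{\Omega}$, so that 1 and 2 hold for $\Omega$. -/

import Mathlib

open Set Filter Topology TopologicalSpace

namespace HolSpaces

noncomputable section

/-- Extension by zero of a function on an open set; it is only used to speak about
derivatives and limits of `f` at points of `Ω` and of its closure. -/
def zeroExt {Ω : Opens ℂ} (f : Ω → ℂ) : ℂ → ℂ := Function.extend Subtype.val f 0

theorem zeroExt_coe {Ω : Opens ℂ} (f : Ω → ℂ) (z : Ω) : zeroExt f z = f z :=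
  Subtype.val_injective.extend_apply f 0 z

theorem zeroExt_of_mem {Ω : Opens ℂ} (f : Ω → ℂ) {z : ℂ} (hz : z ∈ Ω) :
    zeroExt f z = f ⟨z, hz⟩ := zeroExt_coe f ⟨z, hz⟩

theorem zeroExt_add {Ω : Opens ℂ} (f g : Ω → ℂ) : zeroExt (f + g) = zeroExt f + zeroExt g := by
  funext z
  by_cases hz : z ∈ Ω
  · simp [zeroExt_of_mem _ hz]
  · have h : ¬ ∃ a : Ω, (a : ℂ) = z := by rintro ⟨a, rfl⟩; exact hz a.2
    simp [zeroExt, Function.extend_apply' _ _ _ h]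

theorem zeroExt_smul {Ω : Opens ℂ} (c : ℂ) (f : Ω → ℂ) : zeroExt (c • f) = c • zeroExt f := by
  funext z
  by_cases hz : z ∈ Ω
  · simp [zeroExt_of_mem _ hz]
  · have h : ¬ ∃ a : Ω, (a : ℂ) = z := by rintro ⟨a, rfl⟩; exact hz a.2
    simp [zeroExt, Function.extend_apply' _ _ _ h]

/-- The space `H(Ω)` of holomorphic functions `f : Ω → ℂ`. -/
def Hol (Ω : Opens ℂ) : Submodule ℂ (Ω → ℂ) where
  carrier := {f | DifferentiableOn ℂ (zeroExt f) Ω}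
  add_mem' {f g} hf hg := by
    change DifferentiableOn ℂ _ _
    rw [zeroExt_add]
    exact DifferentiableOn.add hf hg
  zero_mem' := by
    refine (differentiableOn_const (c := (0 : ℂ))).congr fun z hz => ?_
    exact zeroExt_of_mem _ hz
  smul_mem' c f hf := by
    change DifferentiableOn ℂ _ _
    rw [zeroExt_smul]
    exact DifferentiableOn.const_smul hf c

theorem differentiableAt_zeroExt {Ω : Opens ℂ} (f : Hol Ω) (z : Ω) :
    DifferentiableAt ℂ (zeroExt f.1) z :=
  DifferentiableOn.differentiableAt f.2 (Ω.isOpen.mem_nhds z.2)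

/-- The complex derivative `f ↦ f'` on `H(Ω)`; the `l`-th derivative of `f` is `(D ^ l) f`. -/
def D {Ω : Opens ℂ} : Module.End ℂ (Hol Ω) where
  toFun f := ⟨fun z => deriv (zeroExt f.1) z, by
    refine (DifferentiableOn.deriv f.2 Ω.isOpen).congr fun z hz => ?_
    exact zeroExt_of_mem _ hz⟩
  map_add' f g := by
    ext z
    change deriv (zeroExt (f.1 + g.1)) z = deriv (zeroExt f.1) z + deriv (zeroExt g.1) z
    rw [zeroExt_add]
    exact deriv_add (differentiableAt_zeroExt f z) (differentiableAt_zeroExt g z)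
  map_smul' c f := by
    ext z
    change deriv (zeroExt (c • f.1)) z = c • deriv (zeroExt f.1) z
    rw [zeroExt_smul]
    exact deriv_const_smul c (differentiableAt_zeroExt f z)

/-- The space `H_F^∞(Ω)`: all derivatives `f^(l)`, `l ∈ F`, are bounded on `Ω`. -/
def HInf (Ω : Opens ℂ) (F : Set ℕ) : Submodule ℂ (Hol Ω) where
  carrier := {f | ∀ l ∈ F, ∃ C : ℝ, ∀ z : Ω, ‖((D ^ l) f).1 z‖ ≤ C}
  add_mem' {f g} hf hg l hl := by
    obtain ⟨C, hC⟩ := hf l hl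
    obtain ⟨C', hC'⟩ := hg l hl
    refine ⟨C + C', fun z => ?_⟩
    rw [map_add]
    exact (norm_add_le _ _).trans (add_le_add (hC z) (hC' z))
  zero_mem' l _ := ⟨0, fun z => by simp⟩
  smul_mem' c f hf l hl := by
    obtain ⟨C, hC⟩ := hf l hl
    refine ⟨‖c‖ * C, fun z => ?_⟩
    rw [map_smul]
    exact (norm_mul_le _ _).trans (mul_le_mul_of_nonneg_left (hC z) (norm_nonneg c))

/-- `g` is a continuous extension of `f : Ω → ℂ` to the closure of `Ω` in `ℂ`. -/
def IsContExt {Ω : Opens ℂ} (f : Ω → ℂ) (g : ℂ → ℂ) : Prop :=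
  ContinuousOn g (closure (Ω : Set ℂ)) ∧ ∀ z : Ω, g z = f z

/-- The space `𝒜_F(Ω)`: all derivatives `f^(l)`, `l ∈ F`, extend continuously to the closure
of `Ω` in `ℂ`. -/
def AF (Ω : Opens ℂ) (F : Set ℕ) : Submodule ℂ (Hol Ω) where
  carrier := {f | ∀ l ∈ F, ∃ g : ℂ → ℂ, IsContExt ((D ^ l) f).1 g}
  add_mem' {f f'} hf hf' l hl := by
    obtain ⟨g, hg, hgf⟩ := hf l hl
    obtain ⟨g', hg', hgf'⟩ := hf' l hl
    refine ⟨g + g', hg.add hg', fun z => ?_⟩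
    rw [map_add]
    simp [hgf, hgf']
  zero_mem' l _ := ⟨0, continuousOn_const, fun z => by simp⟩
  smul_mem' c f hf l hl := by
    obtain ⟨g, hg, hgf⟩ := hf l hl
    refine ⟨c • g, hg.const_smul c, fun z => ?_⟩
    rw [map_smul]
    simp [hgf]

/-- The (unique) continuous extension of `f : Ω → ℂ` to the closure of `Ω`, where it exists:
its value at `z` is the limit of `f` at `z` along `Ω`. -/
def bdryExt {Ω : Opens ℂ} (f : Ω → ℂ) : ℂ → ℂ := extendFrom (Ω : Set ℂ) (zeroExt f)

theorem bdryExt_eq {Ω : Opens ℂ} {f : Ω → ℂ} {g : ℂ → ℂ} (h : IsContExt f g) {z : ℂ}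
    (hz : z ∈ closure (Ω : Set ℂ)) : bdryExt f z = g z := by
  refine extendFrom_eq hz ?_
  refine Tendsto.congr' ?_ ((h.1 z hz).mono_left (nhdsWithin_mono z subset_closure))
  filter_upwards [self_mem_nhdsWithin] with w hw
  exact (h.2 ⟨w, hw⟩).trans (zeroExt_of_mem f hw).symm

/-- The part of the closure of `Ω` in the closed disc of radius `n` about `0`. -/
abbrev closurePart (Ω : Opens ℂ) (n : ℕ) : Type := {z : ℂ // z ∈ closure (Ω : Set ℂ) ∧ ‖z‖ ≤ n}

theorem bddAbove_bdryExt {Ω : Opens ℂ} {f : Ω → ℂ} {g : ℂ → ℂ} (h : IsContExt f g) (n : ℕ) :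
    BddAbove (range fun z : closurePart Ω n => ‖bdryExt f z‖) := by
  have hK : IsCompact (closure (Ω : Set ℂ) ∩ Metric.closedBall 0 n) :=
    (isCompact_closedBall 0 (n : ℝ)).inter_left isClosed_closure
  obtain ⟨C, hC⟩ := hK.exists_bound_of_continuousOn (h.1.mono inter_subset_left)
  refine ⟨C, ?_⟩
  rintro _ ⟨z, rfl⟩
  change ‖bdryExt f z‖ ≤ C
  rw [bdryExt_eq h z.2.1]
  exact hC z ⟨z.2.1, by simpa using z.2.2⟩

/-- The seminorm `sup_{z ∈ Ω} |f^(l)(z)|` on `H_F^∞(Ω)`, for `l ∈ F`. -/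
def supSeminorm (Ω : Opens ℂ) (F : Set ℕ) (l : F) : Seminorm ℂ (HInf Ω F) :=
  Seminorm.of (fun f => ⨆ z : Ω, ‖((D ^ (l : ℕ)) f.1).1 z‖)
    (by
      have key : ∀ f : HInf Ω F, BddAbove (range fun z : Ω => ‖((D ^ (l : ℕ)) f.1).1 z‖) := by
        intro f
        obtain ⟨C, hC⟩ := f.2 l l.2
        exact ⟨C, by rintro _ ⟨z, rfl⟩; exact hC z⟩
      intro f g
      refine Real.iSup_le (fun z => ?_) (add_nonneg (Real.iSup_nonneg fun _ => norm_nonneg _)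
        (Real.iSup_nonneg fun _ => norm_nonneg _))
      have h : ((D ^ (l : ℕ)) (f + g).1).1 z
          = ((D ^ (l : ℕ)) f.1).1 z + ((D ^ (l : ℕ)) g.1).1 z := by
        rw [Submodule.coe_add, map_add]; rfl
      rw [h]
      exact (norm_add_le _ _).trans (add_le_add (le_ciSup (key f) z) (le_ciSup (key g) z)))
    (by
      intro c f
      rw [Real.mul_iSup_of_nonneg (norm_nonneg c)]
      congr 1
      funext z
      rw [Submodule.coe_smul, map_smul]
      exact norm_mul _ _)

/-- The seminorm `sup {|f^(l)(z)| : z ∈ closure Ω, |z| ≤ n}` on `𝒜_F(Ω)`, for `l ∈ F` and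
`n ∈ ℕ`, where `f^(l)` also denotes the continuous extension to the closure. -/
def localSupSeminorm (Ω : Opens ℂ) (F : Set ℕ) (p : F × ℕ) : Seminorm ℂ (AF Ω F) :=
  Seminorm.of (fun f => ⨆ z : closurePart Ω p.2, ‖bdryExt ((D ^ (p.1 : ℕ)) f.1).1 z‖)
    (by
      intro f g
      refine Real.iSup_le (fun z => ?_) (add_nonneg (Real.iSup_nonneg fun _ => norm_nonneg _)
        (Real.iSup_nonneg fun _ => norm_nonneg _))
      obtain ⟨u, hu⟩ := f.2 p.1 p.1.2
      obtain ⟨v, hv⟩ := g.2 p.1 p.1.2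
      have huv : IsContExt ((D ^ (p.1 : ℕ)) (f + g).1).1 (u + v) := by
        refine ⟨hu.1.add hv.1, fun z => ?_⟩
        rw [Submodule.coe_add, map_add]
        simp [hu.2, hv.2]
      have h : bdryExt ((D ^ (p.1 : ℕ)) (f + g).1).1 z
          = bdryExt ((D ^ (p.1 : ℕ)) f.1).1 z + bdryExt ((D ^ (p.1 : ℕ)) g.1).1 z := by
        rw [bdryExt_eq huv z.2.1, bdryExt_eq hu z.2.1, bdryExt_eq hv z.2.1, Pi.add_apply]
      rw [h]
      exact (norm_add_le _ _).trans (add_le_add (le_ciSup (bddAbove_bdryExt hu p.2) z)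
        (le_ciSup (bddAbove_bdryExt hv p.2) z)))
    (by
      intro c f
      rw [Real.mul_iSup_of_nonneg (norm_nonneg c)]
      congr 1
      funext z
      obtain ⟨u, hu⟩ := f.2 p.1 p.1.2
      have hcu : IsContExt ((D ^ (p.1 : ℕ)) (c • f).1).1 (c • u) := by
        refine ⟨hu.1.const_smul c, fun z => ?_⟩
        rw [Submodule.coe_smul, map_smul]
        simp [hu.2]
      rw [bdryExt_eq hcu z.2.1, bdryExt_eq hu z.2.1]
      exact norm_mul _ _)

/-- The seminorm `|f^(l)(z₀)|` on a subspace of `H(Ω)`. -/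
def pointSeminorm {Ω : Opens ℂ} (X : Submodule ℂ (Hol Ω)) (z₀ : Ω) (l : ℕ) : Seminorm ℂ X :=
  Seminorm.of (fun f => ‖((D ^ l) f.1).1 z₀‖)
    (by
      intro f g
      rw [Submodule.coe_add, map_add]
      exact norm_add_le _ _)
    (by
      intro c f
      rw [Submodule.coe_smul, map_smul]
      exact norm_mul _ _)

/-- The seminorms of `H_F^∞(Ω)`: `sup_Ω |f^(l)|` for `l ∈ F`, and `|f^(l)(z₀)|` for
`0 ≤ l < min F`. -/
def seminormsHInf (Ω : Opens ℂ) (F : Set ℕ) (z₀ : Ω) :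
    SeminormFamily ℂ (HInf Ω F) (F ⊕ {l : ℕ // l < sInf F}) :=
  Sum.elim (supSeminorm Ω F) fun l => pointSeminorm (HInf Ω F) z₀ l

/-- The seminorms of `𝒜_F(Ω)`: `sup {|f^(l)(z)| : z ∈ closure Ω, |z| ≤ n}` for `l ∈ F` and
`n ∈ ℕ`, and `|f^(l)(z₀)|` for `0 ≤ l < min F`. -/
def seminormsAF (Ω : Opens ℂ) (F : Set ℕ) (z₀ : Ω) :
    SeminormFamily ℂ (AF Ω F) ((F × ℕ) ⊕ {l : ℕ // l < sInf F}) :=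
  Sum.elim (localSupSeminorm Ω F) fun l => pointSeminorm (AF Ω F) z₀ l

/-- The topology induced by a family of seminorms: the coarsest topology that is finer than the
topology of each of the pseudometrics `p i (x - y)`. -/
@[reducible] def seminormTopology {E ι : Type*} [AddCommGroup E] [Module ℂ E] (p : SeminormFamily ℂ E ι) :
    TopologicalSpace E :=
  ⨅ i, (p i).toSeminormedAddCommGroup.toUniformSpace.toTopologicalSpace

/-- `S` is a dense `G_δ` set in the topology `τ`. -/
def IsDenseGδ {X : Type*} (τ : TopologicalSpace X) (S : Set X) : Prop :=
  @Dense X τ S ∧ @IsGδ X τ S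

/-- The open discs `D₁ = D(c₁, r₁)` and `D₂ = D(c₂, r₂)` satisfy `D₂ ∩ Ω ≠ ∅`, `D₂ ∩ Ωᶜ ≠ ∅` and
`closure D₁ ⊆ D₂ ∩ Ω`. -/
def DiscPair (Ω : Opens ℂ) (c₁ : ℂ) (r₁ : ℝ) (c₂ : ℂ) (r₂ : ℝ) : Prop :=
  0 < r₁ ∧ 0 < r₂ ∧
  (Metric.ball c₂ r₂ ∩ (Ω : Set ℂ)).Nonempty ∧ (Metric.ball c₂ r₂ ∩ (Ω : Set ℂ)ᶜ).Nonempty ∧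
  closure (Metric.ball c₁ r₁) ⊆ Metric.ball c₂ r₂ ∩ (Ω : Set ℂ)

/-- The restriction of `f` to `D(c₁, r₁) ⊆ Ω` has a holomorphic extension to `D(c₂, r₂)`. -/
def ExtendsToDisc {Ω : Opens ℂ} (f : Ω → ℂ) (c₁ : ℂ) (r₁ : ℝ) (c₂ : ℂ) (r₂ : ℝ) : Prop :=
  ∃ G : ℂ → ℂ, DifferentiableOn ℂ G (Metric.ball c₂ r₂) ∧
    ∀ z : Ω, (z : ℂ) ∈ Metric.ball c₁ r₁ → G z = f z

/-- `f` is extendable in the sense of Riemann surfaces. -/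
def Extendable {Ω : Opens ℂ} (f : Ω → ℂ) : Prop :=
  ∃ (c₁ : ℂ) (r₁ : ℝ) (c₂ : ℂ) (r₂ : ℝ), DiscPair Ω c₁ r₁ c₂ r₂ ∧ ExtendsToDisc f c₁ r₁ c₂ r₂

/-- The set of non-extendable functions in a subspace of `H(Ω)`. -/
def nonExtendable {Ω : Opens ℂ} (X : Submodule ℂ (Hol Ω)) : Set X := {f | ¬ Extendable f.1.1}

/-- Every boundary point of `Ω` is the limit of a sequence of points outside the closure. -/
def BoundaryFromOutside (Ω : Opens ℂ) : Prop :=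
  ∀ ζ ∈ frontier (Ω : Set ℂ), ∃ u : ℕ → ℂ,
    (∀ n, u n ∉ closure (Ω : Set ℂ)) ∧ Tendsto u atTop (𝓝 ζ)

/-- A Jordan curve in the plane: an injective continuous image of the circle. -/
def IsJordanCurve (J : Set ℂ) : Prop :=
  ∃ γ : Circle → ℂ, Continuous γ ∧ Function.Injective γ ∧ range γ = J

/-- The boundary of `Ω` is the union of finitely many pairwise disjoint Jordan curves. -/
def BoundedByJordanCurves (Ω : Opens ℂ) : Prop :=
  ∃ 𝒥 : Set (Set ℂ), 𝒥.Finite ∧ (∀ J ∈ 𝒥, IsJordanCurve J) ∧ 𝒥.PairwiseDisjoint id ∧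
    frontier (Ω : Set ℂ) = ⋃₀ 𝒥

end

end HolSpaces

namespace HolSpaces

/-! ### Continuous logarithms -/

/-! Everything about non-extendable functions rests on one countable description. `f` is extendable
exactly when, at some point `q` of a countable dense set, for some rational `R` with `D(q, R)` not
inside `Ω` and some natural `M`, the derivatives at `q` obey `|f^(n)(q)| ≤ M n! / R^n` for all `n`
(`CoeffBound`). Such a bound makes the Taylor series extend `f` to `D(q, R)`; the converse is
`Extendable.exists_coeffBound`.

The `G_δ` property follows because each condition is closed once `f ↦ f^(n)(q)` is continuous.
Density needs one non-extendable `g`: on a line `f + t g` each of the countably many conditions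
holds for at most one `t`, since two would give such a bound for `g`. So completeness of the
function spaces is never used.

To find `g`, Baire's theorem is applied in `ℓ¹` over all `w` outside the closure of `Ω`, to the pole
sums `∑ x_w c_w / (z - w)`, with weights `c_w` small enough that every sum lies in all the spaces.
If all of them were extendable, one condition would hold on a ball of `ℓ¹`, hence, with `2M`, for a
single pole inside `D(q, R)`, which is absurd.

For Jordan curves: if a boundary point had no exterior points nearby, then near it everything off
the curve would belong to the connected set `Ω`. But a Jordan curve has two sides at each of its
points, because it separates the plane and an arc does not. Both facts are proved with continuous
logarithms. -/

/-- Homotopy lifting for the covering `exp : ℂ → ℂ ∖ {0}`. It is used with `A` a point, the plane,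
and the complement of a path. -/
theorem exists_log_homotopy {A : Type*} [TopologicalSpace A] {H : unitInterval × A → ℂ}
    (hH : Continuous H) (hne : ∀ p, H p ≠ 0) {f : A → ℂ} (hf : Continuous f)
    (h0 : ∀ a, Complex.exp (f a) = H (0, a)) :
    ∃ L : unitInterval × A → ℂ, Continuous L ∧ (∀ p, Complex.exp (L p) = H p) ∧
      ∀ a, L (0, a) = f a := by
  let H' : C(unitInterval × A, {z : ℂ // z ≠ 0}) := ⟨fun p => ⟨H p, hne p⟩, by fun_prop⟩
  have h0' : ∀ a, H' (0, a) = ⟨_, Complex.exp_ne_zero ((⟨f, hf⟩ : C(A, ℂ)) a)⟩ := fun a =>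
    Subtype.ext (h0 a).symm
  refine ⟨Complex.isCoveringMap_exp.liftHomotopy H' ⟨f, hf⟩ h0', ContinuousMap.continuous _,
    fun p => ?_, fun a => Complex.isCoveringMap_exp.liftHomotopy_zero H' ⟨f, hf⟩ h0' a⟩
  exact congrArg Subtype.val
    (congrFun (Complex.isCoveringMap_exp.liftHomotopy_lifts H' ⟨f, hf⟩ h0') p)

theorem exists_log_path {h : unitInterval → ℂ} (hh : Continuous h) (hne : ∀ t, h t ≠ 0) :
    ∃ L : unitInterval → ℂ, Continuous L ∧ ∀ t, Complex.exp (L t) = h t := by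
  obtain ⟨L, hL, hexp, -⟩ := exists_log_homotopy (A := Unit) (H := fun p => h p.1) (by fun_prop)
    (fun p => hne _) (f := fun _ => Complex.log (h 0)) continuous_const
    (fun _ => Complex.exp_log (hne 0))
  exact ⟨fun t => L (t, ()), by fun_prop, fun t => hexp _⟩

theorem exists_log_plane {h : ℂ → ℂ} (hh : Continuous h) (hne : ∀ z, h z ≠ 0) :
    ∃ L : ℂ → ℂ, Continuous L ∧ ∀ z, Complex.exp (L z) = h z := by
  -- The plane is contracted to the origin, where `h` is constant.
  obtain ⟨L, hL, hexp, -⟩ := exists_log_homotopy (A := ℂ)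
    (H := fun p => h (((p.1 : ℝ) : ℂ) * p.2)) (by fun_prop)
    (fun p => hne _) (f := fun _ => Complex.log (h 0)) continuous_const
    (fun z => by simpa using Complex.exp_log (hne 0))
  exact ⟨fun z => L (1, z), by fun_prop, fun z => by simpa using hexp (1, z)⟩

theorem eq_of_exp_eq_const {X : Type*} [TopologicalSpace X] {S : Set X} (hS : IsPreconnected S)
    {k : X → ℂ} (hk : ContinuousOn k S) {c : ℂ} (hc : ∀ z ∈ S, Complex.exp (k z) = c)
    {x y : X} (hx : x ∈ S) (hy : y ∈ S) : k x = k y :=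
  Complex.isCoveringMap_exp.constOn_of_comp hS hk
    (fun a ha b hb => Subtype.ext ((hc a ha).trans (hc b hb).symm)) hx hy

/-- Along the circle `M - it` would be a logarithm of the constant `r`, hence constant; comparing `t
= 0` with `t = 2π` gives `2πi = 0`. -/
theorem not_exists_log_sphere (p : ℂ) {r : ℝ} (hr : 0 < r) {M : ℂ → ℂ}
    (hM : ContinuousOn M (Metric.sphere p r)) :
    ¬ ∀ z ∈ Metric.sphere p r, Complex.exp (M z) = z - p := by
  intro hexp
  have hmem : ∀ t : ℝ, circleMap p r t ∈ Metric.sphere p r := circleMap_mem_sphere p hr.le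
  have hcont : Continuous fun t : ℝ => M (circleMap p r t) - t * Complex.I :=
    (hM.comp_continuous (continuous_circleMap p r) hmem).sub (by fun_prop)
  have hconst : ∀ t ∈ (univ : Set ℝ),
      Complex.exp (M (circleMap p r t) - t * Complex.I) = r := by
    intro t _
    rw [Complex.exp_sub, hexp _ (hmem t), circleMap_sub_center, circleMap_zero,
      mul_div_assoc, div_self (Complex.exp_ne_zero _), mul_one]
  have key := eq_of_exp_eq_const isPreconnected_univ hcont.continuousOn hconst
    (mem_univ 0) (mem_univ (2 * Real.pi))
  have hper : circleMap p r (2 * Real.pi) = circleMap p r 0 := by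
    simpa using periodic_circleMap p r 0
  rw [hper] at key
  have hz : (2 * (Real.pi : ℂ)) * Complex.I = 0 := by
    push_cast at key
    linear_combination key
  simp [Real.pi_ne_zero] at hz

/-! ### Separation of the plane by arcs and closed curves -/

theorem isPreconnected_compl_closedBall (R : ℝ) (hR : 0 ≤ R) :
    IsPreconnected (Metric.closedBall (0 : ℂ) R)ᶜ := by
  have h : (Metric.closedBall (0 : ℂ) R)ᶜ
      = (fun p : ℝ × ℝ => (p.1 : ℂ) * Complex.exp (p.2 * Complex.I)) '' (Ioi R ×ˢ univ) := by
    ext z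
    simp only [mem_compl_iff, Metric.mem_closedBall, dist_zero_right, not_le, mem_image, mem_prod,
      mem_Ioi, mem_univ, and_true, Prod.exists]
    constructor
    · intro hz
      exact ⟨‖z‖, z.arg, hz, Complex.norm_mul_exp_arg_mul_I z⟩
    · rintro ⟨a, b, ha, rfl⟩
      simpa [Complex.norm_exp_ofReal_mul_I, abs_of_pos (hR.trans_lt ha)] using ha
  rw [h]
  exact (isPreconnected_Ioi.prod isPreconnected_univ).image _ (by fun_prop)

/-- If an arc is the common complement of two disjoint open sets, one of them bounded, then the
bounded one is empty. -/
theorem eq_empty_of_bounded_of_compl_arc {γ : unitInterval → ℂ} (hγ : Continuous γ)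
    (hinj : Function.Injective γ) {W V : Set ℂ} (hW : IsOpen W) (hV : IsOpen V)
    (hdisj : Disjoint W V) (hunion : W ∪ V = (range γ)ᶜ) {R : ℝ}
    (hVb : V ⊆ Metric.closedBall 0 R) : V = ∅ := by
  classical
  by_contra hne
  obtain ⟨p, hp⟩ := nonempty_iff_ne_empty.2 hne
  have hpA : p ∉ range γ := by
    have : p ∈ (range γ)ᶜ := hunion ▸ Or.inr hp
    exact this
  obtain ⟨L, hL, hexp⟩ := exists_log_path (h := fun t => γ t - p) (by fun_prop)
    (fun t => sub_ne_zero.2 fun h => hpA ⟨t, h⟩)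
  have hemb : IsClosedEmbedding γ := hγ.isClosedEmbedding hinj
  -- By Tietze, the logarithm of `z - p` on the arc extends to a continuous function on the whole
  -- plane.
  obtain ⟨g, hg⟩ := ContinuousMap.exists_extension hemb ⟨L, hL⟩
  have hgL : ∀ t, g (γ t) = L t := fun t => congrArg (fun φ : C(unitInterval, ℂ) => φ t) hg
  have hfr : frontier V ⊆ range γ := by
    intro z hz
    by_contra hzA
    have hzm : z ∈ W ∪ V := hunion ▸ hzA
    rw [hV.frontier_eq] at hz
    rcases hzm with h | h
    · exact (hdisj.symm.closure_left hW).le_bot ⟨hz.1, h⟩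
    · exact hz.2 h
  -- The two formulas agree on `frontier V`, which lies in the arc, and the only zero of `z - p` is
  -- in `V`. So `h` is continuous without zeros and has a logarithm on the plane, yet it equals `z -
  -- p` far out.
  let h : ℂ → ℂ := fun z => if z ∈ V then Complex.exp (g z) else z - p
  have hcont : Continuous h := by
    refine Continuous.if (fun z hz => ?_) (by fun_prop) (by fun_prop)
    obtain ⟨t, rfl⟩ := hfr hz
    rw [hgL, hexp]
  have hnez : ∀ z, h z ≠ 0 := by
    intro z
    by_cases hz : z ∈ V
    · simp [h, hz, Complex.exp_ne_zero]
    · simp only [h, hz, if_false]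
      exact sub_ne_zero.2 fun e => hz (e ▸ hp)
  obtain ⟨M, hM, hMexp⟩ := exists_log_plane hcont hnez
  have hR : 0 ≤ R := by
    have := hVb hp
    exact (norm_nonneg p).trans (by simpa using this)
  -- Both `p` and `V` lie within `R` of the origin, so points of `V` are at distance at most `2R`
  -- from `p`.
  refine not_exists_log_sphere p (r := 2 * R + 1) (by positivity) hM.continuousOn fun z hz => ?_
  rw [hMexp]
  have hzV : z ∉ V := by
    intro hzV
    have h1 := hVb hzV
    have h2 := hVb hp
    rw [mem_closedBall_zero_iff] at h1 h2
    rw [mem_sphere_iff_norm] at hz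
    linarith [norm_sub_le z p]
  simp [h, hzV]

/-- The exterior of a large disc is connected, so it lies in one piece of any separation; the other
piece is bounded, hence empty. -/
theorem isPreconnected_compl_arc {γ : unitInterval → ℂ} (hγ : Continuous γ)
    (hinj : Function.Injective γ) : IsPreconnected (range γ)ᶜ := by
  have hopen : IsOpen (range γ)ᶜ := (isCompact_range hγ).isClosed.isOpen_compl
  obtain ⟨R₀, hR₀⟩ := (isCompact_range hγ).isBounded.subset_closedBall 0
  obtain ⟨R, hR, hsub⟩ : ∃ R : ℝ, 0 ≤ R ∧ range γ ⊆ Metric.closedBall 0 R :=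
    ⟨max R₀ 0, le_max_right _ _, hR₀.trans (Metric.closedBall_subset_closedBall (le_max_left _ _))⟩
  have hfar := isPreconnected_iff_subset_of_disjoint.1 (isPreconnected_compl_closedBall R hR)
  rw [isPreconnected_iff_subset_of_disjoint]
  intro u v hu hv huv hdisj
  have hd : Disjoint ((range γ)ᶜ ∩ u) ((range γ)ᶜ ∩ v) := by
    rw [disjoint_iff_inter_eq_empty, ← inter_inter_distrib_left]
    exact hdisj
  have hun : (range γ)ᶜ ∩ u ∪ (range γ)ᶜ ∩ v = (range γ)ᶜ := by
    rw [← inter_union_distrib_left]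
    exact inter_eq_left.2 huv
  have bdd : ∀ {u v : Set ℂ}, Disjoint ((range γ)ᶜ ∩ u) ((range γ)ᶜ ∩ v) →
      (Metric.closedBall 0 R)ᶜ ⊆ u → (range γ)ᶜ ∩ v ⊆ Metric.closedBall 0 R := by
    intro u v hd h z hz
    by_contra hzR
    exact hd.le_bot ⟨⟨hz.1, h hzR⟩, hz⟩
  have hcs : (Metric.closedBall (0 : ℂ) R)ᶜ ⊆ (range γ)ᶜ := compl_subset_compl.2 hsub
  rcases hfar u v hu hv (hcs.trans huv) (subset_empty_iff.1 (by
    rw [← hdisj]; exact inter_subset_inter_left _ hcs)) with h | h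
  · left
    have he := eq_empty_of_bounded_of_compl_arc hγ hinj (hopen.inter hu) (hopen.inter hv) hd hun
      (bdd hd h)
    intro z hz
    rcases huv hz with h' | h'
    · exact h'
    · exact absurd (he ▸ (⟨hz, h'⟩ : z ∈ (range γ)ᶜ ∩ v)) (notMem_empty z)
  · right
    have he := eq_empty_of_bounded_of_compl_arc hγ hinj (hopen.inter hv) (hopen.inter hu) hd.symm
      (by rw [union_comm]; exact hun) (bdd hd.symm h)
    intro z hz
    rcases huv hz with h' | h'
    · exact absurd (he ▸ (⟨hz, h'⟩ : z ∈ (range γ)ᶜ ∩ u)) (notMem_empty z)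
    · exact h'

/-- The variation of `w ↦ log (w - z)` along a path is a continuous function of `z` off the path. -/
theorem exists_log_variation {α : unitInterval → ℂ} (hα : Continuous α) :
    ∃ L : ℂ → ℂ, ContinuousOn L (range α)ᶜ ∧
      ∀ z ∉ range α, Complex.exp (L z) = (α 1 - z) / (α 0 - z) := by
  classical
  have hne : ∀ (t : unitInterval) (z : ((range α)ᶜ : Set ℂ)), α t - z ≠ 0 := fun t z =>
    sub_ne_zero.2 fun h => z.2 ⟨t, h⟩
  obtain ⟨L, hL, hexp, -⟩ := exists_log_homotopy (A := ((range α)ᶜ : Set ℂ))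
    (H := fun p => (α p.1 - p.2) / (α 0 - p.2))
    ((by fun_prop : Continuous fun p : unitInterval × ((range α)ᶜ : Set ℂ) =>
      α p.1 - (p.2 : ℂ)).div₀ (by fun_prop) fun p => hne 0 p.2)
    (fun p => div_ne_zero (hne _ _) (hne _ _)) (f := fun _ => 0) continuous_const
    (fun z => by simp [div_self (hne 0 z)])
  refine ⟨fun z => if h : z ∈ (range α)ᶜ then L (1, ⟨z, h⟩) else 0, ?_, fun z hz => ?_⟩
  · rw [continuousOn_iff_continuous_domRestrict]
    have : Continuous fun z : ((range α)ᶜ : Set ℂ) => L (1, z) := by fun_prop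
    refine this.congr fun z => ?_
    have hz : (z : ℂ) ∈ (range α)ᶜ := z.2
    simp only [Set.domRestrict_apply]
    rw [dif_pos hz]
  · have hz' : z ∈ (range α)ᶜ := hz
    simp only [dif_pos hz']
    exact hexp (1, ⟨z, hz⟩)

/-- Off both paths, the logarithms `L` of `(α 1 - z) / (α 0 - z)` and `K` of its inverse add up to a
logarithm of `1`. On a connected complement this sum is a constant `c`, so `L` and `c - K` glue to a
logarithm on the plane minus the two endpoints. None exists around `α 0`. -/
theorem not_isPreconnected_compl_union {α β : unitInterval → ℂ} (hα : Continuous α)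
    (hβ : Continuous β) (h01 : α 0 = β 1) (h10 : α 1 = β 0) (hne : α 0 ≠ α 1)
    (hint : range α ∩ range β ⊆ {α 0, α 1}) : ¬ IsPreconnected (range α ∪ range β)ᶜ := by
  classical
  intro hpre
  obtain ⟨L, hL, hLexp⟩ := exists_log_variation hα
  obtain ⟨K, hK, hKexp⟩ := exists_log_variation hβ
  have hsub : ∀ z, z ∉ range α → z ∉ range β → Complex.exp (L z + K z) = 1 := by
    intro z h1 h2
    rw [Complex.exp_add, hLexp z h1, hKexp z h2, ← h01, ← h10]
    have e0 : α 0 - z ≠ 0 := sub_ne_zero.2 fun h => h1 ⟨0, h⟩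
    have e1 : α 1 - z ≠ 0 := sub_ne_zero.2 fun h => h1 ⟨1, h⟩
    field_simp
  have hopA : IsOpen (range α)ᶜ := (isCompact_range hα).isClosed.isOpen_compl
  have hopB : IsOpen (range β)ᶜ := (isCompact_range hβ).isClosed.isOpen_compl
  obtain ⟨c, hcexp, hc⟩ : ∃ c : ℂ, Complex.exp c = 1 ∧
      ∀ z, z ∉ range α → z ∉ range β → L z + K z = c := by
    by_cases hemp : ((range α ∪ range β)ᶜ).Nonempty
    · obtain ⟨y, hy⟩ := hemp
      have hy' : y ∉ range α ∧ y ∉ range β := not_or.1 hy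
      refine ⟨L y + K y, hsub y hy'.1 hy'.2, fun z h1 h2 => ?_⟩
      refine eq_of_exp_eq_const (k := fun z => L z + K z) hpre ?_ (c := 1) ?_ (not_or.2 ⟨h1, h2⟩) hy
      · exact (hL.mono (compl_subset_compl.2 subset_union_left)).add
          (hK.mono (compl_subset_compl.2 subset_union_right))
      · intro z hz
        exact hsub z (not_or.1 hz).1 (not_or.1 hz).2
    · exact ⟨0, Complex.exp_zero, fun z h1 h2 => absurd ⟨z, not_or.2 ⟨h1, h2⟩⟩ hemp⟩
  let Λ : ℂ → ℂ := fun z => if z ∉ range α then L z else c - K z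
  have hΛβ : ∀ z, z ∉ range β → Λ z = c - K z := by
    intro z hz
    by_cases h : z ∈ range α
    · simp only [Λ, h, not_true_eq_false, if_false]
    · simp only [Λ, h, not_false_eq_true, if_true]
      rw [← hc z h hz]; ring
  have hΛα : ∀ z, z ∉ range α → Λ z = L z := fun z hz => by
    simp only [Λ, hz, not_false_eq_true, if_true]
  have hcases : ∀ z, z ≠ α 0 → z ≠ α 1 → z ∉ range α ∨ z ∉ range β := by
    intro z h0 h1
    by_contra hcon
    push Not at hcon
    rcases hint hcon with h | h
    · exact h0 h
    · exact h1 h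
  have hΛc : ∀ z, z ≠ α 0 → z ≠ α 1 → ContinuousAt Λ z := by
    intro z h0 h1
    rcases hcases z h0 h1 with h | h
    · refine (hL.continuousAt (hopA.mem_nhds h)).congr ?_
      filter_upwards [hopA.mem_nhds h] with w hw using (hΛα w hw).symm
    · refine (continuousAt_const.sub (hK.continuousAt (hopB.mem_nhds h))).congr
        (f := fun w => c - K w) ?_
      filter_upwards [hopB.mem_nhds h] with w hw using (hΛβ w hw).symm
  have hΛe : ∀ z, z ≠ α 0 → z ≠ α 1 → Complex.exp (Λ z) = (α 1 - z) / (α 0 - z) := by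
    intro z h0 h1
    rcases hcases z h0 h1 with h | h
    · rw [hΛα z h, hLexp z h]
    · rw [hΛβ z h, Complex.exp_sub, hcexp, hKexp z h, ← h01, ← h10, one_div_div]
  have hd : 0 < ‖α 1 - α 0‖ := norm_pos_iff.2 (sub_ne_zero.2 hne.symm)
  have hsph : ∀ z ∈ Metric.sphere (α 0) (‖α 1 - α 0‖ / 2), z ≠ α 0 ∧ z ≠ α 1 ∧
      (α 1 - z) / (α 1 - α 0) ∈ Complex.slitPlane := by
    intro z hz
    rw [mem_sphere_iff_norm] at hz
    refine ⟨?_, ?_, ?_⟩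
    · rintro rfl
      rw [sub_self, norm_zero] at hz
      linarith
    · rintro rfl
      linarith
    · refine Complex.mem_slitPlane_of_norm_lt_one (z := (α 1 - z) / (α 1 - α 0) - 1) ?_ |> fun h => by
        simpa using h
      have e : (α 1 - z) / (α 1 - α 0) - 1 = -(z - α 0) / (α 1 - α 0) := by
        have := sub_ne_zero.2 hne.symm
        field_simp
        ring
      rw [e, norm_div, norm_neg, hz]
      rw [div_lt_one hd]
      linarith
  -- On this circle `(α 1 - z) / (α 1 - α 0)` is within `1/2` of `1`, so its principal logarithm is
  -- continuous. Subtracting `Λ` and correcting by a constant leaves a logarithm of `z - α 0`.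
  refine not_exists_log_sphere (α 0) (half_pos hd)
    (M := fun z => Complex.log ((α 1 - z) / (α 1 - α 0)) - Λ z + Complex.log (-(α 1 - α 0))) ?_ ?_
  · intro z hz
    obtain ⟨h0, h1, hs⟩ := hsph z hz
    refine ContinuousAt.continuousWithinAt ?_
    refine ContinuousAt.add (ContinuousAt.sub (ContinuousAt.clog ?_ hs) (hΛc z h0 h1))
      continuousAt_const
    exact (continuousAt_const.sub continuousAt_id).div_const _
  · intro z hz
    obtain ⟨h0, h1, hs⟩ := hsph z hz
    have n1 : α 1 - α 0 ≠ 0 := sub_ne_zero.2 hne.symm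
    have n2 : α 1 - z ≠ 0 := sub_ne_zero.2 h1.symm
    have n3 : α 0 - z ≠ 0 := sub_ne_zero.2 h0.symm
    rw [Complex.exp_add, Complex.exp_sub, Complex.exp_log (div_ne_zero n2 n1), hΛe z h0 h1,
      Complex.exp_log (neg_ne_zero.2 n1)]
    field_simp
    ring

/-! ### Jordan curves: separation and local two-sidedness -/

theorem circle_exp_injOn : InjOn (Circle.exp : ℝ → Circle) (Ioc (-Real.pi) Real.pi) :=
  fun x hx y hy h => by
    rw [← Circle.arg_exp hx.1 hx.2, ← Circle.arg_exp hy.1 hy.2, h]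

theorem circle_exp_neg_pi : Circle.exp (-Real.pi) = Circle.exp Real.pi := by
  have h := Circle.periodic_exp (-Real.pi)
  rw [show -Real.pi + 2 * Real.pi = Real.pi by ring] at h
  exact h.symm

theorem exists_exp_eq (u : Circle) : ∃ s ∈ Ioc (-Real.pi) Real.pi, Circle.exp s = u :=
  ⟨Complex.arg u, Complex.arg_mem_Ioc _, Circle.exp_arg u⟩

/-- A Jordan curve separates the plane. -/
theorem not_isPreconnected_compl_jordan {γ : Circle → ℂ} (hγ : Continuous γ)
    (hinj : Function.Injective γ) : ¬ IsPreconnected (range γ)ᶜ := by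
  let α : unitInterval → ℂ := fun t => γ (Circle.exp (Real.pi * t))
  let β : unitInterval → ℂ := fun t => γ (Circle.exp (-Real.pi + Real.pi * t))
  have hunion : range α ∪ range β = range γ := by
    refine Subset.antisymm ?_ ?_
    · rintro z (⟨t, rfl⟩ | ⟨t, rfl⟩)
      exacts [⟨_, rfl⟩, ⟨_, rfl⟩]
    · rintro _ ⟨u, rfl⟩
      obtain ⟨s, hs, rfl⟩ := exists_exp_eq u
      rcases le_total 0 s with h | h
      · refine Or.inl ⟨⟨s / Real.pi, div_nonneg h Real.pi_pos.le,
          (div_le_one Real.pi_pos).2 hs.2⟩, ?_⟩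
        simp only [α]
        rw [mul_div_cancel₀ _ Real.pi_ne_zero]
      · refine Or.inr ⟨⟨(s + Real.pi) / Real.pi, div_nonneg (by linarith [hs.1]) Real.pi_pos.le,
          (div_le_one Real.pi_pos).2 (by linarith)⟩, ?_⟩
        simp only [β]
        rw [mul_div_cancel₀ _ Real.pi_ne_zero]
        ring_nf
  rw [← hunion]
  have hpi := Real.pi_pos
  have α0 : α 0 = γ (Circle.exp 0) := by simp [α]
  have α1 : α 1 = γ (Circle.exp Real.pi) := by simp [α]
  refine not_isPreconnected_compl_union (by fun_prop) (by fun_prop) (by simp [α, β]) ?_ ?_ ?_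
  · rw [α1, ← circle_exp_neg_pi]; simp [β]
  · rw [α0, α1]
    intro h
    exact hpi.ne (circle_exp_injOn ⟨by linarith, hpi.le⟩ ⟨by linarith, le_rfl⟩ (hinj h))
  · rintro _ ⟨⟨t, rfl⟩, ⟨s, hs⟩⟩
    have ht0 : 0 ≤ Real.pi * t := mul_nonneg hpi.le t.2.1
    have ht1 : Real.pi * t ≤ Real.pi := mul_le_of_le_one_right hpi.le t.2.2
    have hs0 : 0 ≤ Real.pi * s := mul_nonneg hpi.le s.2.1
    have hs1 : Real.pi * s ≤ Real.pi := mul_le_of_le_one_right hpi.le s.2.2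
    -- The angle `-π` of `β` is the only one outside the interval where `Circle.exp` is injective,
    -- and it gives `α 1`. Otherwise the angles, one `≥ 0` and the other `≤ 0`, coincide and vanish.
    rcases hs0.eq_or_lt with h | h
    · right
      rw [mem_singleton_iff, ← hs, α1, ← circle_exp_neg_pi]
      simp [β, ← h]
    · left
      have := circle_exp_injOn ⟨by linarith, by linarith⟩ ⟨by linarith, ht1⟩ (hinj hs)
      rw [α0]
      simp only [α]
      rw [show Real.pi * (t : ℝ) = 0 by linarith]

/-- A Jordan curve minus a small arc around one of its points lies in a non-separating arc. -/
theorem exists_arc_of_nhds {γ : Circle → ℂ} (hγ : Continuous γ) (hinj : Function.Injective γ)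
    (ω : Circle) {U : Set ℂ} (hU : U ∈ 𝓝 (γ ω)) :
    ∃ A ⊆ range γ, IsPreconnected Aᶜ ∧ γ ω ∉ A ∧ range γ \ A ⊆ U := by
  have hcont : ContinuousAt (fun x : ℝ => γ (ω * Circle.exp x)) 0 := by fun_prop
  have hU' : U ∈ 𝓝 (γ (ω * Circle.exp 0)) := by simpa using hU
  obtain ⟨δ₀, hδ₀, hball⟩ := Metric.mem_nhds_iff.1 (hcont.preimage_mem_nhds hU')
  have hpi := Real.pi_pos
  obtain ⟨δ, hδ, hδπ, hδle⟩ : ∃ δ : ℝ, 0 < δ ∧ δ < Real.pi ∧ δ ≤ δ₀ :=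
    ⟨min δ₀ (Real.pi / 2), lt_min hδ₀ (by linarith),
      (min_le_right _ _).trans_lt (by linarith), min_le_left _ _⟩
  have hsmall : ∀ x : ℝ, |x| < δ → γ (ω * Circle.exp x) ∈ U := fun x hx =>
    hball (by simpa using hx.trans_le hδle)
  -- Angles measured from the antipode of `ω`: the arc omits exactly the points at angle less than
  -- `δ` from `ω`.
  let a : unitInterval → ℝ := fun t => -(Real.pi - δ) + 2 * (Real.pi - δ) * t
  have ha : ∀ t, a t ∈ Icc (-(Real.pi - δ)) (Real.pi - δ) := by
    intro t
    have h0 := t.2.1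
    have h1 := t.2.2
    constructor <;> simp only [a] <;> nlinarith
  have ha' : ∀ t, a t ∈ Ioc (-Real.pi) Real.pi := fun t =>
    ⟨by linarith [(ha t).1], by linarith [(ha t).2]⟩
  let η : unitInterval → ℂ := fun t => γ (ω * Circle.exp Real.pi * Circle.exp (a t))
  have hη : Continuous η := by simp only [η, a]; fun_prop
  have hηinj : Function.Injective η := by
    intro t s h
    have := circle_exp_injOn (ha' t) (ha' s) (mul_left_cancel (hinj h))
    simp only [a, add_right_inj] at this
    exact Subtype.ext (mul_left_cancel₀ (by linarith) this)
  refine ⟨range η, ?_, isPreconnected_compl_arc hη hηinj, ?_, ?_⟩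
  · rintro _ ⟨t, rfl⟩; exact ⟨_, rfl⟩
  · rintro ⟨t, ht⟩
    have h1 := hinj ht
    rw [mul_assoc, mul_eq_left, ← circle_exp_neg_pi, ← Circle.exp_add] at h1
    have h2 : Circle.exp (a t) = Circle.exp Real.pi := by
      rw [show a t = (-Real.pi + a t) + Real.pi by ring, Circle.exp_add, h1, one_mul]
    have := circle_exp_injOn (ha' t) ⟨by linarith, le_rfl⟩ h2
    linarith [(ha t).2]
  · rintro _ ⟨⟨u, rfl⟩, hu⟩
    obtain ⟨s, hs, hsu⟩ := exists_exp_eq ((ω * Circle.exp Real.pi)⁻¹ * u)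
    have hu' : u = ω * Circle.exp Real.pi * Circle.exp s := by rw [hsu]; group
    rcases lt_or_ge (Real.pi - δ) s with h | h
    · have := hsmall (s - Real.pi) (abs_lt.2 ⟨by linarith, by linarith [hs.2]⟩)
      rwa [show s - Real.pi = -Real.pi + s by ring, Circle.exp_add, circle_exp_neg_pi, ← mul_assoc,
        ← hu'] at this
    · rcases lt_or_ge s (-(Real.pi - δ)) with h' | h'
      · have := hsmall (Real.pi + s) (abs_lt.2 ⟨by linarith [hs.1], by linarith⟩)
        rwa [Circle.exp_add, ← mul_assoc, ← hu'] at this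
      · refine absurd ⟨⟨(s + (Real.pi - δ)) / (2 * (Real.pi - δ)),
          div_nonneg (by linarith) (by linarith), (div_le_one (by linarith)).2 (by linarith)⟩, ?_⟩ hu
        have : 2 * (Real.pi - δ) ≠ 0 := by linarith
        simp only [η, a]
        rw [mul_div_cancel₀ _ this, hu']
        ring_nf

/-- Near each of its points a Jordan curve has at least two sides: the part of a neighbourhood off
the curve is not contained in a single component of the complement. -/
theorem not_subset_of_isPreconnected {γ : Circle → ℂ} (hγ : Continuous γ)
    (hinj : Function.Injective γ) (ω : Circle) {U S : Set ℂ} (hUo : IsOpen U) (hU : γ ω ∈ U)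
    (hS : IsPreconnected S) (hSγ : S ⊆ (range γ)ᶜ) : ¬ U \ range γ ⊆ S := by
  intro hUS
  obtain ⟨A, hAγ, hA, hωA, hAU⟩ := exists_arc_of_nhds hγ hinj ω (hUo.mem_nhds hU)
  have hJ : IsOpen (range γ)ᶜ := (isCompact_range hγ).isClosed.isOpen_compl
  -- Since `U` off the curve lies in `S ⊆ u`, adding `U` to `u` keeps the two pieces disjoint on
  -- `Aᶜ`. They cover this connected set, and `γ ω` is not in the second, so the first is
  -- everything.
  have side : ∀ {u v : Set ℂ}, IsOpen u → IsOpen v → (range γ)ᶜ ⊆ u ∪ v →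
      (range γ)ᶜ ∩ (u ∩ v) = ∅ → S ⊆ u → (range γ)ᶜ ⊆ u := by
    intro u v hu hv huv hd hSu
    have hcov : Aᶜ ⊆ u ∪ U ∪ v ∩ (range γ)ᶜ := by
      intro z hz
      by_cases hzγ : z ∈ range γ
      · exact Or.inl (Or.inr (hAU ⟨hzγ, hz⟩))
      · rcases huv hzγ with h' | h'
        · exact Or.inl (Or.inl h')
        · exact Or.inr ⟨h', hzγ⟩
    have hemp : Aᶜ ∩ ((u ∪ U) ∩ (v ∩ (range γ)ᶜ)) = ∅ := by
      refine eq_empty_of_forall_notMem ?_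
      rintro z ⟨-, h1 | h1, h2, h3⟩
      · exact notMem_empty z (hd ▸ ⟨h3, h1, h2⟩)
      · exact notMem_empty z (hd ▸ ⟨h3, hSu (hUS ⟨h1, h3⟩), h2⟩)
    rcases isPreconnected_iff_subset_of_disjoint.1 hA _ _ (hu.union hUo) (hv.inter hJ) hcov hemp
      with h | h
    · intro z hz
      rcases h (fun hzA => hz (hAγ hzA)) with h' | h'
      · exact h'
      · exact hSu (hUS ⟨h', hz⟩)
    · exact absurd ⟨ω, rfl⟩ (h hωA).2
  refine not_isPreconnected_compl_jordan hγ hinj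
    (isPreconnected_iff_subset_of_disjoint.2 fun u v hu hv huv hd => ?_)
  rcases isPreconnected_iff_subset_of_disjoint.1 hS u v hu hv (hSγ.trans huv)
    (subset_empty_iff.1 (hd ▸ inter_subset_inter_left _ hSγ)) with h | h
  · exact Or.inl (side hu hv huv hd h)
  · exact Or.inr (side hv hu (by rwa [union_comm]) (by rwa [inter_comm v]) h)

/-- By finiteness the other curves form a closed set missing `ζ`. Near a bad `ζ`, points off the
curve through `ζ` are therefore in the closure of `Ω` but not on its boundary, hence in `Ω`,
contradicting two-sidedness. -/
theorem boundaryFromOutside_of_jordan (Ω : Opens ℂ) (hΩ : IsConnected (Ω : Set ℂ))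
    (h : BoundedByJordanCurves Ω) : BoundaryFromOutside Ω := by
  obtain ⟨𝒥, hfin, hJ, hdisj, hfr⟩ := h
  intro ζ hζ
  suffices hc : ζ ∈ closure (closure (Ω : Set ℂ))ᶜ by
    obtain ⟨u, hu, hlim⟩ := mem_closure_iff_seq_limit.1 hc
    exact ⟨u, hu, hlim⟩
  by_contra hcon
  have hζ' := hζ
  rw [hfr] at hζ'
  obtain ⟨J, hJm, hζJ⟩ := hζ'
  obtain ⟨γ, hγ, hinj, rfl⟩ := hJ J hJm
  obtain ⟨ω, rfl⟩ := hζJ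
  have hothers : IsClosed (⋃₀ (𝒥 \ {range γ})) := by
    refine sUnion_eq_biUnion ▸ (hfin.subset sdiff_subset).isClosed_biUnion fun K hK => ?_
    obtain ⟨κ, hκ, -, rfl⟩ := hJ K hK.1
    exact (isCompact_range hκ).isClosed
  refine not_subset_of_isPreconnected hγ hinj ω
    (U := (closure (closure (Ω : Set ℂ))ᶜ)ᶜ ∩ (⋃₀ (𝒥 \ {range γ}))ᶜ) (S := Ω)
    (isClosed_closure.isOpen_compl.inter hothers.isOpen_compl) ⟨hcon, ?_⟩ hΩ.isPreconnected ?_ ?_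
  · rintro ⟨K, hK, hωK⟩
    exact disjoint_left.1 (hdisj hK.1 hJm hK.2) hωK ⟨ω, rfl⟩
  · intro z hz hzγ
    have : z ∈ frontier (Ω : Set ℂ) := hfr ▸ ⟨_, hJm, hzγ⟩
    rw [Ω.isOpen.frontier_eq] at this
    exact this.2 hz
  · rintro z ⟨⟨hz1, hz2⟩, hzγ⟩
    by_contra hzΩ
    have hzc : z ∈ closure (Ω : Set ℂ) := by
      by_contra hn
      exact hz1 (subset_closure hn)
    have : z ∈ frontier (Ω : Set ℂ) := by
      rw [Ω.isOpen.frontier_eq]; exact ⟨hzc, hzΩ⟩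
    rw [hfr] at this
    obtain ⟨K, hK, hzK⟩ := this
    exact hz2 ⟨K, ⟨hK, fun e => hzγ (e ▸ hzK)⟩, hzK⟩

/-! ### Iterated derivatives -/

theorem zeroExt_eventuallyEq {Ω : Opens ℂ} {f : Ω → ℂ} {g : ℂ → ℂ} (h : ∀ z : Ω, f z = g z)
    (z : Ω) : zeroExt f =ᶠ[𝓝 (z : ℂ)] g := by
  filter_upwards [Ω.isOpen.mem_nhds z.2] with w hw
  rw [zeroExt_of_mem f hw, h]

theorem D_pow_succ_apply {Ω : Opens ℂ} (n : ℕ) (f : Hol Ω) (z : Ω) :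
    ((D ^ (n + 1)) f).1 z = deriv (zeroExt ((D ^ n) f).1) z := by
  rw [pow_succ', Module.End.mul_apply]
  rfl

theorem D_pow_apply {Ω : Opens ℂ} (n : ℕ) (f : Hol Ω) (z : Ω) :
    ((D ^ n) f).1 z = iteratedDeriv n (zeroExt f.1) z := by
  induction n generalizing z with
  | zero => simp [zeroExt_coe]
  | succ n ih =>
    rw [D_pow_succ_apply, iteratedDeriv_succ]
    exact (zeroExt_eventuallyEq ih z).deriv_eq

theorem D_pow_add_apply {Ω : Opens ℂ} (n : ℕ) (f g : Hol Ω) (z : Ω) :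
    ((D ^ n) (f + g)).1 z = ((D ^ n) f).1 z + ((D ^ n) g).1 z := by
  rw [map_add]; rfl

theorem D_pow_sub_apply {Ω : Opens ℂ} (n : ℕ) (f g : Hol Ω) (z : Ω) :
    ((D ^ n) (f - g)).1 z = ((D ^ n) f).1 z - ((D ^ n) g).1 z := by
  rw [map_sub]; rfl

theorem D_pow_smul_apply {Ω : Opens ℂ} (n : ℕ) (c : ℂ) (f : Hol Ω) (z : Ω) :
    ((D ^ n) (c • f)).1 z = c * ((D ^ n) f).1 z := by
  rw [map_smul]; rfl

/-- A sequence of functions each of which is the derivative of the preceding one is the sequence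
of derivatives of a holomorphic function. -/
theorem exists_hol_of_hasDerivAt {Ω : Opens ℂ} {u : ℕ → ℂ → ℂ}
    (hu : ∀ l, ∀ z ∈ Ω, HasDerivAt (u l) (u (l + 1) z) z) :
    ∃ f : Hol Ω, ∀ l, ∀ z : Ω, ((D ^ l) f).1 z = u l z := by
  let f₀ : Ω → ℂ := fun z => u 0 z
  have hf : DifferentiableOn ℂ (zeroExt f₀) Ω := fun z hz =>
    ((hu 0 z hz).differentiableAt.congr_of_eventuallyEq
      (zeroExt_eventuallyEq (fun _ => rfl) ⟨z, hz⟩)).differentiableWithinAt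
  refine ⟨⟨f₀, hf⟩, fun l => ?_⟩
  induction l with
  | zero => intro z; rfl
  | succ l ih =>
    intro z
    rw [D_pow_succ_apply, (zeroExt_eventuallyEq ih z).deriv_eq]
    exact (hu l z z.2).deriv

theorem exists_mem_HInf_mem_AF {Ω : Opens ℂ} {u : ℕ → ℂ → ℂ} {B : ℕ → ℝ}
    (hu : ∀ l, ∀ z ∈ Ω, HasDerivAt (u l) (u (l + 1) z) z)
    (hB : ∀ l, ∀ z ∈ Ω, ‖u l z‖ ≤ B l) (hc : ∀ l, ContinuousOn (u l) (closure Ω)) :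
    ∃ f : Hol Ω, (∀ l, ∀ z : Ω, ((D ^ l) f).1 z = u l z) ∧
      ∀ F : Set ℕ, f ∈ HInf Ω F ∧ f ∈ AF Ω F := by
  obtain ⟨f, hf⟩ := exists_hol_of_hasDerivAt hu
  exact ⟨f, hf, fun F => ⟨fun l _ => ⟨B l, fun z => hf l z ▸ hB l z z.2⟩,
    fun l _ => ⟨u l, hc l, fun z => (hf l z).symm⟩⟩⟩

/-! ### The functions `1 / (z - w)` -/

/-- The `l`-th derivative of `z ↦ 1 / (z - w)`. -/
noncomputable def poleDeriv (w : ℂ) (l : ℕ) (z : ℂ) : ℂ := (-1) ^ l * l.factorial / (z - w) ^ (l + 1)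

theorem poleDeriv_zero (w z : ℂ) : poleDeriv w 0 z = 1 / (z - w) := by simp [poleDeriv]

theorem hasDerivAt_poleDeriv {w z : ℂ} (h : z ≠ w) (l : ℕ) :
    HasDerivAt (poleDeriv w l) (poleDeriv w (l + 1) z) z := by
  have h0 : z - w ≠ 0 := sub_ne_zero.2 h
  have h1 : HasDerivAt (fun z : ℂ => (z - w) ^ (l + 1)) ((l + 1 : ℕ) * (z - w) ^ l * 1) z := by
    exact ((hasDerivAt_id z).sub_const w).pow (l + 1)
  have h2 := (hasDerivAt_const z ((-1) ^ l * (l.factorial : ℂ))).div h1 (pow_ne_zero _ h0)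
  refine h2.congr_deriv ?_
  simp only [poleDeriv, Nat.factorial_succ]
  push_cast
  field_simp
  ring

theorem norm_poleDeriv_le {w z : ℂ} {d : ℝ} (hd : 0 < d) (h : d ≤ ‖z - w‖) (l : ℕ) :
    ‖poleDeriv w l z‖ ≤ l.factorial / d ^ (l + 1) := by
  simp only [poleDeriv, norm_div, norm_mul, norm_pow, norm_neg, norm_one, one_pow, one_mul,
    Complex.norm_natCast]
  gcongr

theorem continuousOn_poleDeriv {w : ℂ} {s : Set ℂ} (hw : w ∉ s) (l : ℕ) :
    ContinuousOn (poleDeriv w l) s := fun _ hz =>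
  (hasDerivAt_poleDeriv (ne_of_mem_of_not_mem hz hw) l).continuousAt.continuousWithinAt

theorem exists_pos_le_norm_sub {Ω : Set ℂ} {w : ℂ} (hw : w ∉ closure Ω) :
    ∃ d : ℝ, 0 < d ∧ ∀ z ∈ closure Ω, d ≤ ‖z - w‖ := by
  obtain ⟨d, hd, h⟩ := Metric.isOpen_iff.1 isClosed_closure.isOpen_compl w hw
  refine ⟨d, hd, fun z hz => ?_⟩
  by_contra hlt
  exact h (mem_ball_iff_norm.2 (not_le.1 hlt)) hz

/-- A function with a simple pole in `D(c₂, r₂)` does not extend to this disc. -/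
theorem not_extendsToDisc_of_pole {Ω : Opens ℂ} {f : Ω → ℂ} {a w : ℂ} (ha : a ≠ 0)
    (hwΩ : w ∉ Ω) (hf : ∀ z : Ω, f z = a / ((z : ℂ) - w)) {c₁ : ℂ} {r₁ : ℝ} {c₂ : ℂ} {r₂ : ℝ}
    (hpair : DiscPair Ω c₁ r₁ c₂ r₂) (hw : w ∈ Metric.ball c₂ r₂) :
    ¬ ExtendsToDisc f c₁ r₁ c₂ r₂ := by
  rintro ⟨G, hG, hGf⟩
  obtain ⟨hr₁, -, -, -, hsub⟩ := hpair
  have hb : Metric.ball c₁ r₁ ⊆ Metric.ball c₂ r₂ ∩ Ω := subset_closure.trans hsub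
  have hc : c₁ ∈ Metric.ball c₁ r₁ := Metric.mem_ball_self hr₁
  have hd : DifferentiableOn ℂ (fun z => (z - w) * G z) (Metric.ball c₂ r₂) :=
    ((differentiable_id.sub_const w).differentiableOn).mul hG
  -- `(z - w) G(z)` equals `a` near `c₁`, hence on all of the larger disc; at `w` this reads `0 =
  -- a`.
  have key := (hd.analyticOnNhd Metric.isOpen_ball).eqOn_of_preconnected_of_eventuallyEq
    (analyticOnNhd_const (v := a)) (convex_ball c₂ r₂).isPreconnected (hb hc).1 (by
      filter_upwards [Metric.isOpen_ball.mem_nhds hc] with z hz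
      have hzΩ := (hb hz).2
      have hzw : z - w ≠ 0 := sub_ne_zero.2 fun e => hwΩ (e ▸ hzΩ)
      rw [hGf ⟨z, hzΩ⟩ hz, hf]
      field_simp)
  have := key hw
  simp only [sub_self, zero_mul] at this
  exact ha this.symm

/-! ### Discs meeting the exterior -/

/-- A disc is connected, so if it meets `Ω` and its complement it contains a boundary point, and
then nearby exterior points. -/
theorem exists_mem_diff_closure {Ω : Opens ℂ} (hΩ : BoundaryFromOutside Ω) {c : ℂ} {r : ℝ}
    (h1 : (Metric.ball c r ∩ (Ω : Set ℂ)).Nonempty) (h2 : (Metric.ball c r ∩ (Ω : Set ℂ)ᶜ).Nonempty) :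
    (Metric.ball c r \ closure (Ω : Set ℂ)).Nonempty := by
  obtain ⟨ζ, hζ, hζΩ⟩ : ∃ ζ ∈ Metric.ball c r, ζ ∈ frontier (Ω : Set ℂ) := by
    by_contra hcon
    push Not at hcon
    obtain ⟨z, hz, hzΩ⟩ := h2
    refine hzΩ ((convex_ball c r).isPreconnected.subset_of_closure_inter_subset Ω.isOpen h1 ?_ hz)
    rintro x ⟨hx1, hx2⟩
    by_contra hx3
    exact hcon x hx2 (Ω.isOpen.frontier_eq ▸ ⟨hx1, hx3⟩)
  obtain ⟨u, hu, hlim⟩ := hΩ ζ hζΩ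
  obtain ⟨n, hn⟩ := (hlim.eventually (Metric.isOpen_ball.mem_nhds hζ)).exists
  exact ⟨u n, hn, hu n⟩

/-! ### Extendability in terms of Taylor coefficients -/

/-- The Taylor coefficients of `f` at `q` satisfy the Cauchy estimates of a function bounded by `M`
on the disc `D(q, R)`. -/
def CoeffBound {Ω : Opens ℂ} (f : Hol Ω) (q : Ω) (R M : ℝ) : Prop :=
  ∀ n : ℕ, ‖((D ^ n) f).1 q‖ ≤ M * (n.factorial / R ^ n)

theorem exists_discPair {Ω : Opens ℂ} (q : Ω) {R : ℝ} (hR : 0 < R)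
    (hball : ¬ Metric.ball (q : ℂ) R ⊆ Ω) :
    ∃ r : ℝ, 0 < r ∧ Metric.ball (q : ℂ) r ⊆ Ω ∧ DiscPair Ω q r q R := by
  obtain ⟨ρ, hρ, hsub⟩ := Metric.isOpen_iff.1 Ω.isOpen q q.2
  have hpos : 0 < min ρ R / 2 := half_pos (lt_min hρ hR)
  have hlt : min ρ R / 2 < min ρ R := half_lt_self (lt_min hρ hR)
  refine ⟨min ρ R / 2, hpos, (Metric.ball_subset_ball (hlt.le.trans (min_le_left _ _))).trans hsub,
    hpos, hR, ⟨q, Metric.mem_ball_self hR, q.2⟩, ?_, ?_⟩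
  · obtain ⟨z, hz, hzΩ⟩ := not_subset.1 hball
    exact ⟨z, hz, hzΩ⟩
  · refine Metric.closure_ball_subset_closedBall.trans (subset_inter ?_ ?_)
    · exact Metric.closedBall_subset_ball (hlt.trans_le (min_le_right _ _))
    · exact (Metric.closedBall_subset_ball (hlt.trans_le (min_le_left _ _))).trans hsub

/-- The Taylor series at `q` has radius of convergence at least `R`; its sum is the extension. -/
theorem CoeffBound.extendsToDisc {Ω : Opens ℂ} {f : Hol Ω} {q : Ω} {R M : ℝ} (hR : 0 < R)
    (h : CoeffBound f q R M) {r : ℝ} (hr : Metric.ball (q : ℂ) r ⊆ Ω) :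
    ExtendsToDisc f.1 q r q R := by
  let a : ℕ → ℂ := fun n => (n.factorial : ℂ)⁻¹ * iteratedDeriv n (zeroExt f.1) q
  let p := FormalMultilinearSeries.ofScalars ℂ a
  have hle : ENNReal.ofReal R ≤ p.radius := by
    refine p.le_radius_of_bound M (r := R.toNNReal) fun n => ?_
    rw [FormalMultilinearSeries.ofScalars_norm, Real.coe_toNNReal R hR.le]
    have hn := h n
    rw [D_pow_apply] at hn
    have hf : (0 : ℝ) < n.factorial := by positivity
    simp only [a, norm_mul, norm_inv, Complex.norm_natCast]
    calc (n.factorial : ℝ)⁻¹ * ‖iteratedDeriv n (zeroExt f.1) q‖ * R ^ n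
        ≤ (n.factorial : ℝ)⁻¹ * (M * (n.factorial / R ^ n)) * R ^ n := by gcongr
      _ = M := by field_simp
  have hpos : 0 < p.radius := (ENNReal.ofReal_pos.2 hR).trans_le hle
  have hdiff : DifferentiableOn ℂ p.sum (Metric.ball 0 R) := by
    refine (p.hasFPowerSeriesOnBall hpos).differentiableOn.mono fun z hz => ?_
    rw [Metric.mem_eball, edist_dist]
    refine lt_of_lt_of_le ?_ hle
    exact (ENNReal.ofReal_lt_ofReal_iff hR).2 hz
  refine ⟨fun z => p.sum (z - q), ?_, fun z hz => ?_⟩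
  · refine hdiff.comp ((differentiable_id.sub_const _).differentiableOn) fun z hz => ?_
    simpa [dist_eq_norm] using hz
  · have hT := Complex.taylorSeries_eq_on_ball' (f := zeroExt f.1) hz (f.2.mono hr)
    rw [zeroExt_coe] at hT
    rw [← hT]
    change FormalMultilinearSeries.ofScalarsSum a _ = _
    rw [FormalMultilinearSeries.ofScalarsSum_eq_tsum]
    refine tsum_congr fun n => ?_
    simp [a]

/-- `G` need not agree with `f` on all of `D₂ ∩ Ω`, only on the component `V` containing `D₁`. A
boundary point of `V` inside `D₂` cannot be in `Ω`: a small disc around it would be absorbed into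
`V`. -/
theorem Extendable.exists_boundary_disc {Ω : Opens ℂ} {f : Hol Ω} (h : Extendable f.1) :
    ∃ (V : Set ℂ) (G : ℂ → ℂ) (ζ : ℂ) (ρ : ℝ), IsOpen V ∧ V ⊆ Ω ∧ EqOn G (zeroExt f.1) V ∧
      ζ ∈ closure V ∧ ζ ∉ Ω ∧ 0 < ρ ∧ DifferentiableOn ℂ G (Metric.ball ζ ρ) := by
  obtain ⟨c₁, r₁, c₂, r₂, ⟨hr₁, -, -, ⟨y, hy, hyΩ⟩, hsub⟩, G, hG, hGf⟩ := h
  have hb : Metric.ball c₁ r₁ ⊆ Metric.ball c₂ r₂ ∩ Ω := subset_closure.trans hsub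
  have hc : c₁ ∈ Metric.ball c₁ r₁ := Metric.mem_ball_self hr₁
  have hW : IsOpen (Metric.ball c₂ r₂ ∩ (Ω : Set ℂ)) := Metric.isOpen_ball.inter Ω.isOpen
  let V := connectedComponentIn (Metric.ball c₂ r₂ ∩ (Ω : Set ℂ)) c₁
  have hV : IsOpen V := hW.connectedComponentIn
  have hVW : V ⊆ Metric.ball c₂ r₂ ∩ Ω := connectedComponentIn_subset _ _
  have hcV : c₁ ∈ V := mem_connectedComponentIn (hb hc)
  have hEq : EqOn G (zeroExt f.1) V := by
    refine ((hG.mono (hVW.trans inter_subset_left)).analyticOnNhd hV).eqOn_of_preconnected_of_eventuallyEq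
      ((DifferentiableOn.mono f.2 (hVW.trans inter_subset_right)).analyticOnNhd hV)
      isPreconnected_connectedComponentIn hcV ?_
    filter_upwards [Metric.isOpen_ball.mem_nhds hc] with z hz
    rw [hGf ⟨z, (hb hz).2⟩ hz, zeroExt_of_mem f.1 (hb hz).2]
  obtain ⟨ζ, hζV, hζb, hζ⟩ : ∃ ζ ∈ closure V, ζ ∈ Metric.ball c₂ r₂ ∧ ζ ∉ V := by
    by_contra hcon
    push Not at hcon
    exact hyΩ (hVW ((convex_ball c₂ r₂).isPreconnected.subset_of_closure_inter_subset hV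
      ⟨c₁, (hb hc).1, hcV⟩ (fun z hz => hcon z hz.1 hz.2) hy)).2
  obtain ⟨ρ, hρ, hρsub⟩ := Metric.isOpen_iff.1 Metric.isOpen_ball ζ hζb
  refine ⟨V, G, ζ, ρ, hV, hVW.trans inter_subset_right, hEq, hζV, fun hζΩ => hζ ?_, hρ,
    hG.mono hρsub⟩
  obtain ⟨δ, hδ, hδsub⟩ := Metric.isOpen_iff.1 hW ζ ⟨hζb, hζΩ⟩
  obtain ⟨z, hz, hzV⟩ := mem_closure_iff.1 hζV _ Metric.isOpen_ball (Metric.mem_ball_self hδ)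
  have h1 : Metric.ball ζ δ ⊆ connectedComponentIn (Metric.ball c₂ r₂ ∩ (Ω : Set ℂ)) z :=
    (convex_ball ζ δ).isPreconnected.subset_connectedComponentIn hz hδsub
  rw [← connectedComponentIn_eq hzV] at h1
  exact h1 (Metric.mem_ball_self hδ)

theorem Extendable.exists_coeffBound {Ω : Opens ℂ} {f : Hol Ω} (h : Extendable f.1) {x : ℕ → Ω}
    (hx : DenseRange x) :
    ∃ (i : ℕ) (R : ℚ) (M : ℕ), (0 : ℝ) < R ∧ ¬ Metric.ball (x i : ℂ) R ⊆ Ω ∧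
      CoeffBound f (x i) R M := by
  obtain ⟨V, G, ζ, ρ, hV, hVΩ, hEq, hζ, hζΩ, hρ, hG⟩ := h.exists_boundary_disc
  have hne : (V ∩ Metric.ball ζ (ρ / 4)).Nonempty := by
    obtain ⟨z, hz, hzV⟩ := mem_closure_iff.1 hζ _ Metric.isOpen_ball
      (Metric.mem_ball_self (show 0 < ρ / 4 by positivity))
    exact ⟨z, hzV, hz⟩
  obtain ⟨i, hi⟩ := hx.exists_mem_open
    ((hV.inter Metric.isOpen_ball).preimage (continuous_subtype_val (p := fun z => z ∈ Ω)))
    (let ⟨z, hz⟩ := hne; ⟨⟨z, hVΩ hz.1⟩, hz⟩)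
  -- `R > ρ/4` makes the disc about `x i` reach `ζ ∉ Ω`; `R < ρ/2` keeps its closure inside `D(ζ,
  -- ρ)`, where `G` obeys the Cauchy estimates.
  obtain ⟨R, hR1, hR2⟩ := exists_rat_btwn (show ρ / 4 < ρ / 2 by linarith)
  have hR : (0 : ℝ) < R := by linarith
  have hdist : dist (x i : ℂ) ζ < ρ / 4 := hi.2
  have hcb : Metric.closedBall (x i : ℂ) R ⊆ Metric.ball ζ ρ :=
    Metric.closedBall_subset_ball' (by linarith)
  obtain ⟨C, hC⟩ := (isCompact_closedBall (x i : ℂ) (R : ℝ)).exists_bound_of_continuousOn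
    (hG.continuousOn.mono hcb)
  obtain ⟨M, hM⟩ := exists_nat_ge C
  refine ⟨i, R, M, hR, fun hsub => hζΩ (hsub (by rw [Metric.mem_ball, dist_comm]; linarith)), ?_⟩
  intro n
  have hev : zeroExt f.1 =ᶠ[𝓝 (x i : ℂ)] G := by
    filter_upwards [hV.mem_nhds hi.1] with z hz using (hEq hz).symm
  rw [D_pow_apply, (hev.iteratedDeriv n).self_of_nhds, ← mul_div_assoc, mul_comm (M : ℝ)]
  refine Complex.norm_iteratedDeriv_le_of_forall_mem_sphere_norm_le n hR
    ((hG.mono hcb).diffContOnCl_ball subset_rfl) fun z hz => ?_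
  exact (hC z (Metric.sphere_subset_closedBall hz)).trans hM

/-! ### Topologies induced by seminorms -/

theorem tendsto_seminormTopology {E ι β : Type*} [AddCommGroup E] [Module ℂ E]
    (p : SeminormFamily ℂ E ι) {l : Filter β} {φ : β → E} {g : E} :
    Tendsto φ l (@nhds E (seminormTopology p) g) ↔
      ∀ i, Tendsto (fun x => p i (φ x - g)) l (𝓝 0) := by
  rw [nhds_iInf, tendsto_iInf]
  refine forall_congr' fun i => ?_
  let _ := (p i).toSeminormedAddCommGroup
  exact tendsto_iff_norm_sub_tendsto_zero

/-- `s (f - g)` tends to `0` as `f` tends to `g`. -/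
def IsSmallNear {E : Type*} [AddCommGroup E] (τ : TopologicalSpace E) (s : E → ℝ) : Prop :=
  ∀ g, Tendsto (fun f => s (f - g)) (@nhds E τ g) (𝓝 0)

theorem isSmallNear_seminorm {E ι : Type*} [AddCommGroup E] [Module ℂ E]
    (p : SeminormFamily ℂ E ι) (i : ι) : IsSmallNear (seminormTopology p) (p i) := fun _ =>
  (tendsto_seminormTopology p).1 tendsto_id i

theorem IsSmallNear.add_const_mul {E : Type*} [AddCommGroup E] {τ : TopologicalSpace E}
    {s t : E → ℝ} (hs : IsSmallNear τ s) (ht : IsSmallNear τ t) (c : ℝ) :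
    IsSmallNear τ fun f => s f + c * t f := fun g => by
  simpa using (hs g).add ((ht g).const_mul c)

theorem IsSmallNear.const_mul {E : Type*} [AddCommGroup E] {τ : TopologicalSpace E}
    {t : E → ℝ} (ht : IsSmallNear τ t) (c : ℝ) : IsSmallNear τ fun f => c * t f := fun g => by
  simpa using (ht g).const_mul c

/-! ### Evaluation of derivatives is continuous -/

section

variable {Ω : Opens ℂ} {X : Submodule ℂ (Hol Ω)}

/-- Near `q` the `n`-th derivative is bounded uniformly by a function that is small near `0`. -/
def LocallyControlled (τ : TopologicalSpace X) (n : ℕ) (q : Ω) : Prop :=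
  ∃ r > 0, Metric.ball (q : ℂ) r ⊆ Ω ∧ ∃ s : X → ℝ, IsSmallNear τ s ∧
    ∀ f : X, ∀ z : Ω, (z : ℂ) ∈ Metric.ball (q : ℂ) r → ‖((D ^ n) f.1).1 z‖ ≤ s f

theorem LocallyControlled.continuous_eval {τ : TopologicalSpace X} {n : ℕ} {q : Ω}
    (h : LocallyControlled τ n q) : @Continuous X ℂ τ _ fun f => ((D ^ n) f.1).1 q := by
  obtain ⟨r, hr, -, s, hs, hb⟩ := h
  refine continuous_iff_continuousAt.2 fun g => ?_
  refine tendsto_iff_norm_sub_tendsto_zero.2 (squeeze_zero (fun _ => norm_nonneg _) (fun f => ?_)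
    (hs g))
  rw [← D_pow_sub_apply]
  exact hb (f - g) q (Metric.mem_ball_self hr)

/-- Cauchy's estimate on circles of radius `r / 4` about points of the half-size disc. -/
theorem LocallyControlled.succ {τ : TopologicalSpace X} {n : ℕ} {q : Ω}
    (h : LocallyControlled τ n q) : LocallyControlled τ (n + 1) q := by
  obtain ⟨r, hr, hrΩ, s, hs, hb⟩ := h
  refine ⟨r / 2, half_pos hr, (Metric.ball_subset_ball (half_le_self hr.le)).trans hrΩ,
    fun f => (r / 4)⁻¹ * s f, hs.const_mul _, fun f z hz => ?_⟩
  rw [Metric.mem_ball] at hz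
  have hsub : Metric.closedBall (z : ℂ) (r / 4) ⊆ Metric.ball (q : ℂ) r :=
    Metric.closedBall_subset_ball' (by linarith)
  change _ ≤ (r / 4)⁻¹ * s f
  rw [D_pow_succ_apply, ← div_eq_inv_mul]
  refine Complex.norm_deriv_le_of_forall_mem_sphere_norm_le (by positivity)
    ((DifferentiableOn.mono ((D ^ n) f.1).2 (hsub.trans hrΩ)).diffContOnCl_ball subset_rfl)
    fun w hw => ?_
  have hw' := hsub (Metric.sphere_subset_closedBall hw)
  rw [zeroExt_of_mem _ (hrΩ hw')]
  exact hb f ⟨w, hrΩ hw'⟩ hw'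

/-- Mean value inequality on a disc: control of the next derivative carries control of this one from
a single point `y` to the whole disc. The radius does not depend on `y`. -/
theorem LocallyControlled.spread {τ : TopologicalSpace X} {n : ℕ} {q : Ω}
    (h : LocallyControlled τ (n + 1) q) :
    ∃ r > 0, Metric.ball (q : ℂ) r ⊆ Ω ∧ ∀ y : Ω, (y : ℂ) ∈ Metric.ball (q : ℂ) r →
      ∀ t : X → ℝ, IsSmallNear τ t → (∀ f : X, ‖((D ^ n) f.1).1 y‖ ≤ t f) →
      ∃ t' : X → ℝ, IsSmallNear τ t' ∧
        ∀ f : X, ∀ z : Ω, (z : ℂ) ∈ Metric.ball (q : ℂ) r → ‖((D ^ n) f.1).1 z‖ ≤ t' f := by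
  obtain ⟨r, hr, hrΩ, s, hs, hb⟩ := h
  refine ⟨r, hr, hrΩ, fun y hy t ht hyt => ⟨fun f => t f + (2 * r) * s f,
    ht.add_const_mul hs _, fun f z hz => ?_⟩⟩
  have hmv := (convex_ball (q : ℂ) r).norm_image_sub_le_of_norm_deriv_le
    (f := zeroExt ((D ^ n) f.1).1) (C := s f)
    (fun w hw => differentiableAt_zeroExt _ ⟨w, hrΩ hw⟩)
    (fun w hw => by
      have := hb f ⟨w, hrΩ hw⟩ hw
      rwa [D_pow_succ_apply] at this) hy hz
  rw [zeroExt_coe, zeroExt_coe] at hmv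
  have hs0 : 0 ≤ s f := (norm_nonneg _).trans (hb f y hy)
  have hd : ‖(z : ℂ) - y‖ ≤ 2 * r := by
    rw [← dist_eq_norm]
    rw [Metric.mem_ball] at hy hz
    linarith [dist_triangle_right (z : ℂ) y q]
  calc ‖((D ^ n) f.1).1 z‖ ≤ ‖((D ^ n) f.1).1 y‖ + ‖((D ^ n) f.1).1 z - ((D ^ n) f.1).1 y‖ :=
        norm_le_norm_add_norm_sub' _ _
    _ ≤ t f + s f * (2 * r) := add_le_add (hyt f) (hmv.trans (by gcongr))
    _ = t f + (2 * r) * s f := by ring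

/-- The points where the `n`-th derivative is controlled form a set that is open and closed relative
to `Ω` and contains `z₀`. Here connectedness and the seminorms at `z₀` enter. -/
theorem LocallyControlled.pred (hΩ : IsConnected (Ω : Set ℂ)) {τ : TopologicalSpace X} {n : ℕ}
    (h : ∀ q, LocallyControlled τ (n + 1) q) {z₀ : Ω} {t₀ : X → ℝ} (ht₀ : IsSmallNear τ t₀)
    (hb₀ : ∀ f : X, ‖((D ^ n) f.1).1 z₀‖ ≤ t₀ f) (q : Ω) : LocallyControlled τ n q := by
  let T : Set ℂ := {y | ∃ hy : y ∈ Ω, ∃ t : X → ℝ, IsSmallNear τ t ∧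
    ∀ f : X, ‖((D ^ n) f.1).1 ⟨y, hy⟩‖ ≤ t f}
  have hball : ∀ y : Ω, ∃ r > 0, Metric.ball (y : ℂ) r ⊆ Ω ∧
      ((T ∩ Metric.ball (y : ℂ) r).Nonempty → Metric.ball (y : ℂ) r ⊆ T) := by
    intro y
    obtain ⟨r, hr, hrΩ, hsp⟩ := (h y).spread
    refine ⟨r, hr, hrΩ, ?_⟩
    rintro ⟨x, ⟨hxΩ, t, ht, hbx⟩, hx⟩ z hz
    obtain ⟨t', ht', hb'⟩ := hsp ⟨x, hxΩ⟩ hx t ht hbx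
    exact ⟨hrΩ hz, t', ht', fun f => hb' f ⟨z, hrΩ hz⟩ hz⟩
  have hTo : IsOpen T := by
    refine Metric.isOpen_iff.2 fun y hy => ?_
    obtain ⟨r, hr, -, hrT⟩ := hball ⟨y, hy.1⟩
    exact ⟨r, hr, hrT ⟨y, hy, Metric.mem_ball_self hr⟩⟩
  have hTΩ : (Ω : Set ℂ) ⊆ T := by
    refine hΩ.isPreconnected.subset_of_closure_inter_subset hTo
      ⟨z₀, z₀.2, z₀.2, t₀, ht₀, hb₀⟩ ?_
    rintro y ⟨hyc, hyΩ⟩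
    obtain ⟨r, hr, -, hrT⟩ := hball ⟨y, hyΩ⟩
    obtain ⟨x, hx, hxT⟩ := mem_closure_iff.1 hyc _ Metric.isOpen_ball (Metric.mem_ball_self hr)
    exact hrT ⟨x, hxT, hx⟩ (Metric.mem_ball_self hr)
  obtain ⟨r, hr, hrΩ, hsp⟩ := (h q).spread
  obtain ⟨_, t, ht, hbt⟩ := hTΩ q.2
  exact ⟨r, hr, hrΩ, hsp q (Metric.mem_ball_self hr) t ht hbt⟩

/-- Order `m` is controlled directly by `p`; higher orders follow by Cauchy's estimate, lower ones
by integrating from `z₀`. -/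
theorem locallyControlled_of_seminorms (hΩ : IsConnected (Ω : Set ℂ)) {ι : Type*}
    {p : SeminormFamily ℂ X ι} {m : ℕ} {z₀ : Ω}
    (h₁ : ∀ N : ℕ, ∃ i, ∀ f : X, ∀ z : Ω, ‖(z : ℂ)‖ ≤ N → ‖((D ^ m) f.1).1 z‖ ≤ p i f)
    (h₂ : ∀ l < m, ∃ i, ∀ f : X, ‖((D ^ l) f.1).1 z₀‖ ≤ p i f) (n : ℕ) (q : Ω) :
    LocallyControlled (seminormTopology p) n q := by
  have hm : ∀ q, LocallyControlled (seminormTopology p) m q := by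
    intro q
    obtain ⟨r, hr, hrΩ⟩ := Metric.isOpen_iff.1 Ω.isOpen q q.2
    obtain ⟨N, hN⟩ := exists_nat_ge (‖(q : ℂ)‖ + r)
    obtain ⟨i, hi⟩ := h₁ N
    refine ⟨r, hr, hrΩ, p i, isSmallNear_seminorm p i, fun f z hz => hi f z ?_⟩
    have h1 := norm_le_norm_add_norm_sub' (z : ℂ) q
    rw [mem_ball_iff_norm] at hz
    linarith
  rcases le_total m n with hmn | hnm
  · induction n, hmn using Nat.le_induction with
    | base => exact hm q
    | succ n _ ih => exact ih.succ
  · revert q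
    induction hnm using Nat.decreasingInduction with
    | self => exact hm
    | of_succ n hn ih =>
      obtain ⟨i, hi⟩ := h₂ n hn
      exact LocallyControlled.pred hΩ ih (isSmallNear_seminorm p i) hi

/-! ### Density and the `G_δ` property -/

theorem CoeffBound.extendable {f : Hol Ω} {q : Ω} {R M : ℝ} (hR : 0 < R)
    (hball : ¬ Metric.ball (q : ℂ) R ⊆ Ω) (h : CoeffBound f q R M) : Extendable f.1 := by
  obtain ⟨r, -, hr, hp⟩ := exists_discPair q hR hball
  exact ⟨q, r, q, R, hp, h.extendsToDisc hR hr⟩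

theorem isGδ_nonExtendable (hΩ : (Ω : Set ℂ).Nonempty) {τ : TopologicalSpace X}
    (h : ∀ n q, @Continuous X ℂ τ _ fun f => ((D ^ n) f.1).1 q) :
    @IsGδ X τ (nonExtendable X) := by
  have : Nonempty Ω := hΩ.to_subtype
  let x : ℕ → Ω := denseSeq Ω
  let ι := {k : ℕ × ℚ × ℕ // (0 : ℝ) < k.2.1 ∧ ¬ Metric.ball (x k.1 : ℂ) k.2.1 ⊆ Ω}
  have heq : nonExtendable X
      = ⋂ k : ι, {f : X | CoeffBound f.1 (x k.1.1) k.1.2.1 k.1.2.2}ᶜ := by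
    ext f
    simp only [nonExtendable, mem_ofPred_eq, mem_iInter, mem_compl_iff]
    constructor
    · exact fun hf k hk => hf (hk.extendable k.2.1 k.2.2)
    · intro hf hext
      obtain ⟨i, R, M, hR, hb, hc⟩ := hext.exists_coeffBound (denseRange_denseSeq Ω)
      exact hf ⟨(i, R, M), hR, hb⟩ hc
  rw [heq]
  refine IsGδ.iInter_of_isOpen fun k => IsClosed.isOpen_compl (self := ?_)
  simp only [CoeffBound, ofPred_forall]
  exact isClosed_iInter fun n => isClosed_le (continuous_norm.comp (h n _)) continuous_const

theorem countable_setOf_extendable {f g : Hol Ω} (hΩ : (Ω : Set ℂ).Nonempty)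
    (hg : ¬ Extendable g.1) : {t : ℂ | Extendable (f + t • g).1}.Countable := by
  have : Nonempty Ω := hΩ.to_subtype
  let x : ℕ → Ω := denseSeq Ω
  have hsub : {t : ℂ | Extendable (f + t • g).1} ⊆ ⋃ k : ℕ × ℚ × ℕ,
      {t | (0 : ℝ) < k.2.1 ∧ ¬ Metric.ball (x k.1 : ℂ) k.2.1 ⊆ Ω ∧
        CoeffBound (f + t • g) (x k.1) k.2.1 k.2.2} := by
    intro t ht
    obtain ⟨i, R, M, h⟩ := Extendable.exists_coeffBound ht (denseRange_denseSeq Ω)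
    exact mem_iUnion.2 ⟨(i, R, M), h⟩
  refine (countable_iUnion fun k => Subsingleton.countable ?_).mono hsub
  rintro t ⟨hR, hb, ht⟩ t' ⟨-, -, ht'⟩
  by_contra hne
  have hd : t - t' ≠ 0 := sub_ne_zero.2 hne
  -- Two parameters with the same `q`, `R`, `M` express `g` as a difference quotient, which inherits
  -- a coefficient bound.
  refine hg (CoeffBound.extendable (M := ‖t - t'‖⁻¹ * (k.2.2 + k.2.2)) hR hb fun n => ?_)
  have hid : ((D ^ n) g).1 (x k.1) = (t - t')⁻¹ *
      (((D ^ n) (f + t • g)).1 (x k.1) - ((D ^ n) (f + t' • g)).1 (x k.1)) := by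
    rw [D_pow_add_apply, D_pow_add_apply, D_pow_smul_apply, D_pow_smul_apply]
    field_simp
    ring
  rw [hid, norm_mul, norm_inv, mul_assoc, add_mul]
  gcongr
  exact (norm_sub_le _ _).trans (add_le_add (ht n) (ht' n))

theorem dense_nonExtendable (hΩ : (Ω : Set ℂ).Nonempty) {ι : Type*} (p : SeminormFamily ℂ X ι)
    {g : X} (hg : ¬ Extendable g.1.1) : @Dense X (seminormTopology p) (nonExtendable X) := by
  intro f
  rw [@mem_closure_iff_frequently X (seminormTopology p)]
  have hlim : Tendsto (fun t : ℂ => f + t • g) (𝓝 0) (@nhds X (seminormTopology p) f) := by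
    refine (tendsto_seminormTopology p).2 fun i => ?_
    have : (fun t : ℂ => p i (f + t • g - f)) = fun t => ‖t‖ * p i g := by
      funext t
      exact (congrArg (p i) (add_sub_cancel_left f (t • g))).trans (map_smul_eq_mul (p i) t g)
    rw [this]
    simpa using (tendsto_norm_zero (E := ℂ)).mul_const (p i g)
  refine hlim.frequently (p := fun f => f ∈ nonExtendable X) ?_
  exact mem_closure_iff_frequently.1
    ((countable_setOf_extendable (f := f.1) hΩ hg).dense_compl ℂ 0)

end

/-! ### A function with poles in all directions -/

theorem summable_norm_lp_one {ι : Type*} (x : lp (fun _ : ι => ℂ) 1) : Summable fun w => ‖x w‖ := by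
  simpa using (lp.memℓp x).summable (by simp)

/-- Makes every derivative of a pole sum at a point a continuous functional of the coefficients, so
that the sets in the Baire argument are closed. -/
theorem exists_lp_one_pairing {ι : Type*} {b : ι → ℂ} {B : ℝ} (hb : ∀ w, ‖b w‖ ≤ B) :
    ∃ T : lp (fun _ : ι => ℂ) 1 →L[ℂ] ℂ, ∀ x, T x = ∑' w, x w * b w := by
  have hs : ∀ x : lp (fun _ : ι => ℂ) 1, Summable fun w => x w * b w := fun x =>
    Summable.of_norm_bounded ((summable_norm_lp_one x).mul_right B) fun w => by
      rw [norm_mul]; gcongr; exact hb w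
  let T : lp (fun _ : ι => ℂ) 1 →ₗ[ℂ] ℂ :=
    { toFun := fun x => ∑' w, x w * b w
      map_add' := fun x y => by
        rw [← (hs x).tsum_add (hs y)]
        exact tsum_congr fun w => by rw [lp.coeFn_add, Pi.add_apply, add_mul]
      map_smul' := fun c x => by
        rw [RingHom.id_apply, smul_eq_mul, ← tsum_mul_left]
        exact tsum_congr fun w => by
          rw [lp.coeFn_smul, Pi.smul_apply, smul_eq_mul, mul_assoc] }
  refine ⟨T.mkContinuous B fun x => ?_, fun x => rfl⟩
  have hx : ‖x‖ = ∑' w, ‖x w‖ := by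
    simpa using lp.norm_eq_tsum_rpow (p := 1) (by simp) x
  rw [hx, mul_comm, ← tsum_mul_right]
  refine tsum_of_norm_bounded ((summable_norm_lp_one x).mul_right B).hasSum fun w => ?_
  rw [norm_mul]; gcongr; exact hb w

/-- The weight `exp (-1/d)` beats `d^{-(l+1)}` for every `l` at once, by `t^{l+1}/(l+1)! ≤ exp t` at
`t = 1/d`. The bound is independent of the pole, however close to `Ω` it lies. -/
theorem norm_exp_mul_poleDeriv_le {w z : ℂ} {d : ℝ} (hd : 0 < d) (h : d ≤ ‖z - w‖) (l : ℕ) :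
    ‖(Real.exp (-d⁻¹) : ℂ) * poleDeriv w l z‖ ≤ l.factorial * (l + 1).factorial := by
  rw [norm_mul, Complex.norm_real, Real.norm_eq_abs, Real.abs_exp]
  have h1 := Real.pow_div_factorial_le_exp d⁻¹ (inv_nonneg.2 hd.le) (l + 1)
  have hfac : (0 : ℝ) < (l + 1).factorial := by positivity
  have h2 : Real.exp (-d⁻¹) * d⁻¹ ^ (l + 1) ≤ (l + 1).factorial := by
    rw [div_le_iff₀ hfac] at h1
    rw [Real.exp_neg, inv_mul_le_iff₀ (Real.exp_pos _)]
    exact h1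
  calc Real.exp (-d⁻¹) * ‖poleDeriv w l z‖
      ≤ Real.exp (-d⁻¹) * (l.factorial / d ^ (l + 1)) := by
        gcongr; exact norm_poleDeriv_le hd h l
    _ = l.factorial * (Real.exp (-d⁻¹) * d⁻¹ ^ (l + 1)) := by
        rw [inv_pow, div_eq_mul_inv]; ring
    _ ≤ l.factorial * (l + 1).factorial := by gcongr

/-- Sums of simple poles outside the closure of `Ω`, with summable weights. -/
theorem exists_hol_poleSum {Ω : Opens ℂ} (hΩ : IsConnected (Ω : Set ℂ)) {ι : Type*} {e : ι → ℂ}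
    {k : ℕ → ι → ℂ → ℂ} {B : ℕ → ℝ}
    (hk : ∀ l w, ∀ z ∈ Ω, HasDerivAt (k l w) (k (l + 1) w z) z)
    (hB : ∀ l w, ∀ z ∈ closure (Ω : Set ℂ), ‖k l w z‖ ≤ B l)
    (hc : ∀ l w, ContinuousOn (k l w) (closure (Ω : Set ℂ))) (he : Summable fun w => ‖e w‖) :
    ∃ f : Hol Ω, (∀ l, ∀ z : Ω, ((D ^ l) f).1 z = ∑' w, e w * k l w z) ∧
      ∀ F : Set ℕ, f ∈ HInf Ω F ∧ f ∈ AF Ω F := by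
  have hbd : ∀ l w, ∀ z ∈ closure (Ω : Set ℂ), ‖e w * k l w z‖ ≤ ‖e w‖ * B l := by
    intro l w z hz
    rw [norm_mul]; gcongr; exact hB l w z hz
  have hsum : ∀ l, Summable fun w => ‖e w‖ * B l := fun l => he.mul_right (B l)
  refine exists_mem_HInf_mem_AF (u := fun l z => ∑' w, e w * k l w z)
    (B := fun l => ∑' w, ‖e w‖ * B l) (fun l z hz => ?_) (fun l z hz => ?_) (fun l => ?_)
  · exact hasDerivAt_tsum_of_isPreconnected (hsum (l + 1)) Ω.isOpen hΩ.isPreconnected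
      (fun w y hy => (hk l w y hy).const_mul (e w)) (fun w y hy => hbd (l + 1) w y (subset_closure hy))
      hz (Summable.of_norm_bounded (hsum l) fun w => hbd l w z (subset_closure hz)) hz
  · exact tsum_of_norm_bounded (hsum l).hasSum fun w => hbd l w z (subset_closure hz)
  · exact continuousOn_tsum (fun w => continuousOn_const.mul (hc l w)) (hsum l) (hbd l)

theorem exists_not_extendable {Ω : Opens ℂ} (hΩ : IsConnected (Ω : Set ℂ))
    (hout : BoundaryFromOutside Ω) :
    ∃ g : Hol Ω, (∀ F : Set ℕ, g ∈ HInf Ω F ∧ g ∈ AF Ω F) ∧ ¬ Extendable g.1 := by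
  have : Nonempty Ω := hΩ.nonempty.to_subtype
  let ι := {w : ℂ // w ∉ closure (Ω : Set ℂ)}
  choose d hd hdle using fun w : ι => exists_pos_le_norm_sub w.2
  let k : ℕ → ι → ℂ → ℂ := fun l w z => (Real.exp (-(d w)⁻¹) : ℂ) * poleDeriv w l z
  have hkB : ∀ l w, ∀ z ∈ closure (Ω : Set ℂ), ‖k l w z‖ ≤ l.factorial * (l + 1).factorial :=
    fun l w z hz => norm_exp_mul_poleDeriv_le (hd w) (hdle w z hz) l
  choose g hg hgmem using fun x : lp (fun _ : ι => ℂ) 1 =>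
    exists_hol_poleSum hΩ (k := k) (B := fun l => l.factorial * (l + 1).factorial)
      (fun l w z hz => (hasDerivAt_poleDeriv
        (ne_of_mem_of_not_mem (subset_closure hz) w.2) l).const_mul _) hkB
      (fun l w => continuousOn_const.mul (continuousOn_poleDeriv w.2 l)) (summable_norm_lp_one x)
  choose T hT using fun (l : ℕ) (z : Ω) =>
    exists_lp_one_pairing (b := fun w => k l w z) (hkB l · z (subset_closure z.2))
  have hgT : ∀ x l z, ((D ^ l) (g x)).1 z = T l z x := fun x l z => (hg x l z).trans (hT l z x).symm
  by_contra! hcon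
  let q : ℕ → Ω := denseSeq Ω
  let κ := {i : ℕ × ℚ × ℕ // (0 : ℝ) < i.2.1 ∧ ¬ Metric.ball (q i.1 : ℂ) i.2.1 ⊆ Ω}
  have hclosed : ∀ i : κ, IsClosed {x | CoeffBound (g x) (q i.1.1) i.1.2.1 i.1.2.2} := by
    intro i
    simp only [CoeffBound, ofPred_forall, hgT]
    exact isClosed_iInter fun n => isClosed_le (T n _).continuous.norm continuous_const
  have hcover : ⋃ i : κ, {x | CoeffBound (g x) (q i.1.1) i.1.2.1 i.1.2.2} = univ := by
    refine eq_univ_of_forall fun x => ?_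
    obtain ⟨i, R, M, hR, hb, h⟩ := (hcon (g x) (hgmem x)).exists_coeffBound (denseRange_denseSeq Ω)
    exact mem_iUnion.2 ⟨⟨(i, R, M), hR, hb⟩, h⟩
  -- Baire's theorem in `ℓ¹`; its index set may be uncountable, only completeness matters.
  obtain ⟨⟨⟨i, R, M⟩, hR, hb⟩, x₀, hx₀⟩ := nonempty_interior_of_iUnion_of_closed hclosed hcover
  obtain ⟨ρ, hρ, hρsub⟩ := Metric.mem_nhds_iff.1 (mem_interior_iff_mem_nhds.1 hx₀)
  have hball : ∀ x ∈ Metric.ball x₀ ρ, CoeffBound (g x) (q i) R M := fun x hx => hρsub hx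
  obtain ⟨z, hz, hzΩ⟩ := not_subset.1 hb
  obtain ⟨w, hw, hwΩ⟩ := exists_mem_diff_closure hout
    ⟨q i, Metric.mem_ball_self hR, (q i).2⟩ ⟨z, hz, hzΩ⟩
  -- Moving from the centre `x₀` in the direction of a single pole `w ∈ D(q i, R)` stays in the
  -- ball; subtraction isolates that pole at the cost of doubling `M`.
  let y : lp (fun _ : ι => ℂ) 1 := lp.single 1 (⟨w, hwΩ⟩ : ι) ((ρ / 2 : ℝ) : ℂ)
  have hy : x₀ + y ∈ Metric.ball x₀ ρ := by
    rw [mem_ball_iff_norm, add_sub_cancel_left, lp.norm_single (by simp), Complex.norm_real,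
      Real.norm_eq_abs, abs_of_pos (by positivity)]
    exact half_lt_self hρ
  have hybd : CoeffBound (g y) (q i) R (M + M) := by
    intro n
    have h1 := hball _ hy n
    have h2 := hball _ (Metric.mem_ball_self hρ) n
    rw [hgT] at h1 h2 ⊢
    have h3 : T n (q i) y = T n (q i) (x₀ + y) - T n (q i) x₀ := by rw [map_add]; ring
    rw [h3, add_mul]
    exact (norm_sub_le _ _).trans (add_le_add h1 h2)
  obtain ⟨r, -, hr, hp⟩ := exists_discPair (q i) hR hb
  refine not_extendsToDisc_of_pole (a := ((ρ / 2 : ℝ) : ℂ) * Real.exp (-(d ⟨w, hwΩ⟩)⁻¹))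
    ?_ (fun h => hwΩ (subset_closure h)) (fun z => ?_) hp hw (hybd.extendsToDisc hR hr)
  · exact mul_ne_zero (Complex.ofReal_ne_zero.2 (by positivity))
      (Complex.ofReal_ne_zero.2 (Real.exp_pos _).ne')
  · have h0 := hg y 0 z
    rw [pow_zero, Module.End.one_apply] at h0
    rw [h0, tsum_eq_single (⟨w, hwΩ⟩ : ι)]
    · simp only [y, k, lp.single_apply_self, poleDeriv_zero]
      ring
    · intro w' hw'
      simp only [y, lp.single_apply_ne _ _ _ hw', zero_mul]

/-! ### The two spaces -/

theorem continuous_eval_HInf {Ω : Opens ℂ} (hΩ : IsConnected (Ω : Set ℂ)) {F : Set ℕ}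
    (hF : F.Nonempty) (z₀ : Ω) (n : ℕ) (q : Ω) :
    @Continuous _ _ (seminormTopology (seminormsHInf Ω F z₀)) _
      fun f : HInf Ω F => ((D ^ n) f.1).1 q := by
  refine (locallyControlled_of_seminorms hΩ (m := sInf F) (z₀ := z₀) (fun N => ?_)
    (fun l hl => ⟨Sum.inr ⟨l, hl⟩, fun f => le_rfl⟩) n q).continuous_eval
  refine ⟨Sum.inl ⟨sInf F, Nat.sInf_mem hF⟩, fun f z _ => ?_⟩
  -- Boundedness is needed because a real supremum defaults to `0` on unbounded families.
  obtain ⟨C, hC⟩ := f.2 (sInf F) (Nat.sInf_mem hF)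
  exact le_ciSup (f := fun z : Ω => ‖((D ^ sInf F) f.1).1 z‖)
    ⟨C, by rintro _ ⟨z, rfl⟩; exact hC z⟩ z

theorem continuous_eval_AF {Ω : Opens ℂ} (hΩ : IsConnected (Ω : Set ℂ)) {F : Set ℕ}
    (hF : F.Nonempty) (z₀ : Ω) (n : ℕ) (q : Ω) :
    @Continuous _ _ (seminormTopology (seminormsAF Ω F z₀)) _
      fun f : AF Ω F => ((D ^ n) f.1).1 q := by
  refine (locallyControlled_of_seminorms hΩ (m := sInf F) (z₀ := z₀) (fun N => ?_)
    (fun l hl => ⟨Sum.inr ⟨l, hl⟩, fun f => le_rfl⟩) n q).continuous_eval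
  refine ⟨Sum.inl (⟨sInf F, Nat.sInf_mem hF⟩, N), fun f z hz => ?_⟩
  obtain ⟨u, hu⟩ := f.2 (sInf F) (Nat.sInf_mem hF)
  have h := le_ciSup (bddAbove_bdryExt hu N) ⟨(z : ℂ), subset_closure z.2, hz⟩
  dsimp only at h
  rw [bdryExt_eq hu (subset_closure z.2), hu.2] at h
  exact h

theorem exists_hol_pole {Ω : Opens ℂ} {w : ℂ} (hw : w ∉ closure (Ω : Set ℂ)) :
    ∃ f : Hol Ω, (∀ z : Ω, f.1 z = 1 / ((z : ℂ) - w)) ∧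
      ∀ F : Set ℕ, f ∈ HInf Ω F ∧ f ∈ AF Ω F := by
  obtain ⟨d, hd, hdle⟩ := exists_pos_le_norm_sub hw
  obtain ⟨f, hf, hmem⟩ := exists_mem_HInf_mem_AF (Ω := Ω) (u := poleDeriv w)
    (B := fun l => l.factorial / d ^ (l + 1))
    (fun l z hz => hasDerivAt_poleDeriv (ne_of_mem_of_not_mem (subset_closure hz) hw) l)
    (fun l z hz => norm_poleDeriv_le hd (hdle z (subset_closure hz)) l)
    (continuousOn_poleDeriv hw)
  exact ⟨f, fun z => (hf 0 z).trans (poleDeriv_zero w z), hmem⟩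

end HolSpaces

theorem mainTheorem12 (Ω : TopologicalSpace.Opens ℂ) (hΩ : IsConnected (Ω : Set ℂ)) :
    -- the non-extendable functions are dense and G_δ in both spaces
    (HolSpaces.BoundaryFromOutside Ω → ∀ F : Set ℕ, F.Nonempty → ∀ z₀ : Ω,
      HolSpaces.IsDenseGδ (HolSpaces.seminormTopology (HolSpaces.seminormsHInf Ω F z₀))
        (HolSpaces.nonExtendable (HolSpaces.HInf Ω F)) ∧
      HolSpaces.IsDenseGδ (HolSpaces.seminormTopology (HolSpaces.seminormsAF Ω F z₀))
        (HolSpaces.nonExtendable (HolSpaces.AF Ω F))) ∧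
    -- the witnesses: every admissible pair of discs is defeated by some 1 / (z - w)
    (HolSpaces.BoundaryFromOutside Ω → ∀ (c₁ : ℂ) (r₁ : ℝ) (c₂ : ℂ) (r₂ : ℝ),
      HolSpaces.DiscPair Ω c₁ r₁ c₂ r₂ →
        (Metric.ball c₂ r₂ \ closure (Ω : Set ℂ)).Nonempty) ∧
    (∀ w : ℂ, w ∉ closure (Ω : Set ℂ) → ∃ f : HolSpaces.Hol Ω,
      (∀ z : Ω, f.1 z = 1 / ((z : ℂ) - w)) ∧
      (∀ F : Set ℕ, f ∈ HolSpaces.HInf Ω F ∧ f ∈ HolSpaces.AF Ω F) ∧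
      ∀ (c₁ : ℂ) (r₁ : ℝ) (c₂ : ℂ) (r₂ : ℝ), HolSpaces.DiscPair Ω c₁ r₁ c₂ r₂ →
        w ∈ Metric.ball c₂ r₂ → ¬ HolSpaces.ExtendsToDisc f.1 c₁ r₁ c₂ r₂) ∧
    -- domains bounded by finitely many disjoint Jordan curves are a special case
    (HolSpaces.BoundedByJordanCurves Ω → HolSpaces.BoundaryFromOutside Ω) := by
  refine ⟨fun hout F hF z₀ => ?_, fun hout c₁ r₁ c₂ r₂ hp => ?_, fun w hw => ?_,
    HolSpaces.boundaryFromOutside_of_jordan Ω hΩ⟩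
  · obtain ⟨g, hg, hne⟩ := HolSpaces.exists_not_extendable hΩ hout
    exact ⟨⟨HolSpaces.dense_nonExtendable hΩ.nonempty _ (g := ⟨g, (hg F).1⟩) hne,
        HolSpaces.isGδ_nonExtendable hΩ.nonempty (HolSpaces.continuous_eval_HInf hΩ hF z₀)⟩,
      HolSpaces.dense_nonExtendable hΩ.nonempty _ (g := ⟨g, (hg F).2⟩) hne,
      HolSpaces.isGδ_nonExtendable hΩ.nonempty (HolSpaces.continuous_eval_AF hΩ hF z₀)⟩
  · exact HolSpaces.exists_mem_diff_closure hout hp.2.2.1 hp.2.2.2.1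
  · obtain ⟨f, hf, hmem⟩ := HolSpaces.exists_hol_pole hw
    exact ⟨f, hf, hmem, fun c₁ r₁ c₂ r₂ hp hwb => HolSpaces.not_extendsToDisc_of_pole one_ne_zero
      (fun h => hw (subset_closure h)) hf hp hwb⟩
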